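/- Let $G=\mathrm{GL}_2(\mathbb C)$ and write $n(x)=\begin{pmatrix}1&x\\0&1\end{pmatrix}$, $t(a)=\begin{pmatrix}a&0\\0&1\end{pmatrix}$, $z(c)=\begin{pmatrix}c&0\\0&c\end{pmatrix}$, $w_0=\begin{pmatrix}0&1\\1&0\end{pmatrix}$; let $N=\{n(x):x\in\mathbb C\}$, let $A$ be the diagonal subgroup and put $U=A(N\smallsetminus\{1\})w_0N$. For $\nu\in\mathbb C$ and $l\in\mathbb Z$ let $\chi_{\nu,l}(z)=|z|^{2\nu}(z/|z|)^{l}$ for $z\in\mathbb C^\times$. Let $\pi$ be an infinite-dimensional irreducible unitary representation of $G$ on a complex Hilbert space, with trivial central character. Let $(\mu,m)\in\mathbb C\times\mathbb Z$ be parameters of $\pi$, i.e. $m$ is even and $\pi=\pi_{\mu,m}$ is the principal series representation $\pi(\chi_{\mu,m/2},\chi_{-\mu,-m/2})$ (the unique irreducible quotient of the unitarily normalized induced representation $\mathrm{Ind}_B^G(\chi_{\mu,m/2},\chi_{-\mu,-m/2})$ from the upper triangular subgroup $B$, the two characters being permuted first if $\operatorname{Re}\mu<0$). Let $$L(\pi,\tfrac12)=\prod_{\pm}2(2\pi)^{-(\frac12\pm\mu+\frac{|m|}4)}\,\Gamma\!\left(\tfrac12\pm\mu+\tfrac{|m|}4\right)$$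 (here $\pi$ on the right is the number). Let $\lambda\in\mathbb C^\times$, $\mathrm{Tr}(z)=z+\bar z$, $e(t)=e^{2\pi i t}$ and $\psi(z)=e(\mathrm{Tr}(\lambda z))$. For $\mu'\in\mathbb C$, $m'\in\mathbb Z$ put $J_{\mu',m'}(z)=J_{-2\mu'-\frac12m'}(z)\,J_{-2\mu'+\frac12m'}(\bar z)$, where $J_\nu$ is the classical Bessel function of the first kind (and $\arg\bar z=-\arg z$), and, for $z\in\mathbb C^\times$, $$\boldsymbol J_{\mu',m'}(z)=\begin{cases}\dfrac{2\pi^2}{\sin(2\pi\mu')}\bigl(J_{\mu',m'}(4\pi\sqrt z)-J_{-\mu',-m'}(4\pi\sqrt z)\bigr), & m'\text{ even},\\[2mm] \dfrac{2\pi^2 i}{\cos(2\pi\mu')}\bigl(J_{\mu',m'}(4\pi\sqrt z)+J_{-\mu',-m'}(4\pi\sqrt z)\bigr), & m'\text{ odd},\end{cases}$$ where $\sqrt z$ is the principal square root and where, if $4\mu'\in2\mathbb Z+m'$, the right-hand side is replaced by its limit in $\mu'$. The relative Bessel function $i=i_{\pi,\psi}:G\to\mathbb C$ is defined by $i(g)=0$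 for $g\notin U$ and $$i\bigl(t(a)z(c)n(x)w_0n(y)\bigr)=\psi(y)\,\frac{e\bigl(\mathrm{Tr}(\lambda/2x)\bigr)\,|\lambda/2x|\,\boldsymbol J_{\frac12\mu,\frac12m}\bigl(\lambda^2/16x^2\bigr)}{L(\pi,\frac12)}\qquad(a,c,x\in\mathbb C^\times,\ y\in\mathbb C).$$ Then $i$ is locally integrable on $G$ with respect to Haar measure; in particular, for every $f\in C_c^\infty(G)$, $$\int_G|f(g)\,i(g)|\,dg<\infty.$$ -/

import Mathlib

open MeasureTheory Filter Topology
open scoped ContDiff MatrixGroups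

noncomputable section

namespace RelBessel

/-! ### Elements of `GL₂(ℂ)` -/

/-- The group `G = GL₂(ℂ)`, with its usual topology. -/
abbrev G : Type := GL (Fin 2) ℂ

/-- `n(x) = (1 x; 0 1)`. -/
def nMat (x : ℂ) : G :=
  Matrix.GeneralLinearGroup.mkOfDetNeZero !![1, x; 0, 1] (by simp)

/-- `diag(a, b)`; the diagonal subgroup `A` consists of these elements. -/
def dMat (a b : ℂˣ) : G :=
  Matrix.GeneralLinearGroup.mkOfDetNeZero !![(a : ℂ), 0; 0, (b : ℂ)] (by simp)

/-- `t(a) = diag(a, 1)`. -/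
def tMat (a : ℂˣ) : G := dMat a 1

/-- `z(c) = diag(c, c)`; the centre `Z` consists of these elements. -/
def zMat (c : ℂˣ) : G := dMat c c

/-- The Weyl element `w₀ = (0 1; 1 0)`. -/
def w0 : G :=
  Matrix.GeneralLinearGroup.mkOfDetNeZero !![0, 1; 1, 0] (by simp)

/-- `U = A (N ∖ {0}) w₀ N`. -/
def U : Set G :=
  {g | ∃ (a c : ℂˣ) (x y : ℂ), x ≠ 0 ∧ g = tMat a * zMat c * nMat x * w0 * nMat y}

/-! ### Unitary representations and principal series -/

/-- The quasi-character `χ_{ν,l}(z) = ‖z‖^ν (z/|z|)^l` of `ℂˣ`, where `‖z‖ = |z|²`. -/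
def chi (ν : ℂ) (l : ℤ) (z : ℂˣ) : ℂ :=
  (((‖(z : ℂ)‖ ^ 2 : ℝ) : ℂ)) ^ ν * ((z : ℂ) / (‖(z : ℂ)‖ : ℂ)) ^ l

/-- The space of the (unitarily normalized) induced representation
`Ind_B^G(χ_{ν₁,l₁}, χ_{ν₂,l₂})`, realized on the continuous functions `φ` on `G` with
`φ((a *; 0 b) g) = χ_{ν₁,l₁}(a) χ_{ν₂,l₂}(b) ‖a/b‖^{1/2} φ(g)` (note `‖a/b‖^{1/2} = |a|/|b|`).
It carries the topology of uniform convergence on compact sets, which is the topology of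
uniform convergence on the maximal compact subgroup. -/
def indSpace (ν₁ : ℂ) (l₁ : ℤ) (ν₂ : ℂ) (l₂ : ℤ) : Submodule ℂ C(G, ℂ) where
  carrier := {φ | ∀ (a b : ℂˣ) (x : ℂ) (g : G), φ (nMat x * dMat a b * g) =
    chi ν₁ l₁ a * chi ν₂ l₂ b * ((‖(a : ℂ)‖ / ‖(b : ℂ)‖ : ℝ) : ℂ) * φ g}
  zero_mem' := by intro a b x g; simp
  add_mem' := by
    intro φ φ' h h' a b x g
    have h1 := h a b x g
    have h2 := h' a b x g
    simp only [ContinuousMap.add_apply]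
    rw [h1, h2]; ring
  smul_mem' := by
    intro c φ h a b x g
    have h1 := h a b x g
    simp only [ContinuousMap.smul_apply, smul_eq_mul]
    rw [h1]; ring

/-- `G` acts on the induced representation by right translation. -/
def rightTranslate {ν₁ : ℂ} {l₁ : ℤ} {ν₂ : ℂ} {l₂ : ℤ} (h : G)
    (φ : indSpace ν₁ l₁ ν₂ l₂) : indSpace ν₁ l₁ ν₂ l₂ :=
  ⟨(φ : C(G, ℂ)).comp ⟨fun x => x * h, continuous_mul_const h⟩, by
    intro a b x g
    have := φ.2 a b x (g * h)
    simpa [mul_assoc] using this⟩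

section Rep

variable {H : Type*} [NormedAddCommGroup H] [InnerProductSpace ℂ H] [CompleteSpace H]

/-- `π` is an irreducible unitary representation of `G` on the Hilbert space `H`: it acts by
unitary operators, is strongly continuous, and `H` is nonzero without proper nonzero closed
invariant subspaces. -/
structure IsIrreducibleUnitary (π : G →* unitary (H →L[ℂ] H)) : Prop where
  continuous : ∀ v : H, Continuous fun g : G => (π g : H →L[ℂ] H) v
  nontrivial : Nontrivial H
  irreducible : ∀ V : Submodule ℂ H, IsClosed (V : Set H) →
    (∀ (g : G), ∀ v ∈ V, (π g : H →L[ℂ] H) v ∈ V) → V = ⊥ ∨ V = ⊤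

/-- The irreducible unitary representation `π` is (the unitary completion of) the irreducible
quotient of `Ind_B^G(χ_{ν₁,l₁}, χ_{ν₂,l₂})`, where `Re ν₁ ≥ Re ν₂`: there is a nonzero continuous
`G`-equivariant map from the induced representation to `π`. -/
def IsLanglandsQuotient (π : G →* unitary (H →L[ℂ] H))
    (ν₁ : ℂ) (l₁ : ℤ) (ν₂ : ℂ) (l₂ : ℤ) : Prop :=
  ν₂.re ≤ ν₁.re ∧ ∃ T : indSpace ν₁ l₁ ν₂ l₂ →L[ℂ] H, T ≠ 0 ∧
    ∀ (g : G) (φ : indSpace ν₁ l₁ ν₂ l₂), T (rightTranslate g φ) = (π g : H →L[ℂ] H) (T φ)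

/-- The first angular parameter of `π_{μ,m}`: `m/2` for `m` even, `(m+1)/2` for `m` odd. -/
def angle₁ (m : ℤ) : ℤ := if Even m then m / 2 else (m + 1) / 2

/-- The second angular parameter of `π_{μ,m}`: `-m/2` for `m` even, `-(m-1)/2` for `m` odd. -/
def angle₂ (m : ℤ) : ℤ := if Even m then -(m / 2) else -((m - 1) / 2)

/-- `π` is (equivalent to) the principal series representation
`π_{μ,m} = π(χ_{μ,l₁}, χ_{-μ,l₂})`; the two characters are permuted if necessary,
in order that the induced representation have a unique irreducible quotient. -/
def IsPrincipalSeries (π : G →* unitary (H →L[ℂ] H)) (μ : ℂ) (m : ℤ) : Prop :=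
  IsLanglandsQuotient π μ (angle₁ m) (-μ) (angle₂ m) ∨
    IsLanglandsQuotient π (-μ) (angle₂ m) μ (angle₁ m)

end Rep

/-- The local factor `L(s, χ_{ν,l}) = 2 (2π)^{-(s+ν+|l|/2)} Γ(s+ν+|l|/2)` over `ℂ`. -/
def lChar (s ν : ℂ) (l : ℤ) : ℂ := Complex.Gammaℂ (s + ν + ((|l| : ℤ) : ℂ) / 2)

/-- `L(s, π_{μ,m})`. -/
def lFactor (s μ : ℂ) (m : ℤ) : ℂ := lChar s μ (angle₁ m) * lChar s (-μ) (angle₂ m)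

/-! ### Bessel functions -/

/-- The classical Bessel function `J_ν(z)` of complex order, on the principal branch. -/
def besselJ (ν z : ℂ) : ℂ :=
  (z / 2) ^ ν * ∑' k : ℕ, (-1) ^ k * (z / 2) ^ (2 * k) /
    ((k.factorial : ℂ) * Complex.Gamma (ν + k + 1))

/-- `J_{μ,m}(z) = J_{-2μ-m/2}(z) J_{-2μ+m/2}(z̄)`. It is only used for `z ≠ 0` with `Re z ≥ 0`
(`z` is `4π` times a principal square root), where the principal arguments of `z` and `z̄`
are opposite, as they should be. -/
def besselJJ (μ : ℂ) (m : ℤ) (z : ℂ) : ℂ :=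
  besselJ (-2 * μ - m / 2) z * besselJ (-2 * μ + m / 2) (starRingEnd ℂ z)

/-- The formula for the bold Bessel function `𝑱_{μ,m}(z)` in the generic case `4μ ∉ 2ℤ + m`,
`√z` being the principal square root. -/
def boldJGeneric (μ : ℂ) (m : ℤ) (z : ℂ) : ℂ :=
  let w : ℂ := 4 * Real.pi * z ^ (1 / 2 : ℂ)
  if Even m then
    2 * Real.pi ^ 2 / Complex.sin (2 * Real.pi * μ) * (besselJJ μ m w - besselJJ (-μ) (-m) w)
  else
    2 * Real.pi ^ 2 * Complex.I / Complex.cos (2 * Real.pi * μ) *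
      (besselJJ μ m w + besselJJ (-μ) (-m) w)

open Classical in
/-- The bold Bessel function `𝑱_{μ,m}(z)`: the generic formula, replaced by its limit in the
order `μ` in the nongeneric case `4μ ∈ 2ℤ + m`. -/
def boldJ (μ : ℂ) (m : ℤ) (z : ℂ) : ℂ :=
  if ∃ k : ℤ, 4 * μ = 2 * k + m then
    limUnder (𝓝[≠] μ) (fun μ' => boldJGeneric μ' m z)
  else boldJGeneric μ m z

/-! ### The relative Bessel function -/

/-- The additive character `ψ_lam(z) = e(lam z + conj (lam z))`, `e(t) = exp(2π i t)`. -/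
def psi (lam z : ℂ) : ℂ :=
  Complex.exp (2 * Real.pi * Complex.I * (lam * z + starRingEnd ℂ (lam * z)))

/-- The value of the relative Bessel function at `n(x) w₀`, `x ≠ 0`:
`e(Tr(lam/2x)) |lam/2x| 𝑱_{μ/2,m/2}(lam²/16x²) / L(π_{μ,m}, 1/2)` (`m` is even). -/
def relBesselN (μ : ℂ) (m : ℤ) (lam x : ℂ) : ℂ :=
  psi 1 (lam / (2 * x)) * (‖lam / (2 * x)‖ : ℂ) *
    boldJ (μ / 2) (m / 2) (lam ^ 2 / (16 * x ^ 2)) / lFactor (1 / 2) μ m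

open Classical in
/-- The relative Bessel function `i_{π,ψ}` of `π = π_{μ,m}` and `ψ = ψ_lam`, extended by zero
off `U`. On `U` the element `g = t(a) z(c) n(x) w₀ n(y)` has
`x = -g₁₁ g₂₁ / det g` and `y = g₂₂ / g₂₁`. -/
def relBessel (μ : ℂ) (m : ℤ) (lam : ℂ) (g : G) : ℂ :=
  if g ∈ U then
    psi lam (g.1 1 1 / g.1 1 0) * relBesselN μ m lam (-(g.1 0 0 * g.1 1 0) / g.1.det)
  else 0

lemma decomp_val (a c : ℂˣ) (x y : ℂ) :
    (tMat a * zMat c * nMat x * w0 * nMat y).1 =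
      !![(a : ℂ) * c * x, (a : ℂ) * c * (x * y + 1); (c : ℂ), (c : ℂ) * y] := by
  simp only [tMat, zMat, dMat, nMat, w0, Matrix.GeneralLinearGroup.mkOfDetNeZero, Units.val_mul,
    Matrix.GeneralLinearGroup.mk', Matrix.unitOfDetInvertible]
  ext i j
  fin_cases i <;> fin_cases j <;> simp [Matrix.mul_apply, Fin.sum_univ_two]
  ring

/-- The defining formula of the relative Bessel function on `U`: it is left `A`-invariant and
right `(ψ, N)`-equivariant, with the given values at `n(x) w₀`. -/
lemma relBessel_apply (μ : ℂ) (m : ℤ) (lam : ℂ) (a c : ℂˣ) (x y : ℂ) (hx : x ≠ 0) :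
    relBessel μ m lam (tMat a * zMat c * nMat x * w0 * nMat y) =
      psi lam y * relBesselN μ m lam x := by
  have hU : tMat a * zMat c * nMat x * w0 * nMat y ∈ U := ⟨a, c, x, y, hx, rfl⟩
  rw [relBessel, if_pos hU, decomp_val]
  have ha : (a : ℂ) ≠ 0 := a.ne_zero
  have hc : (c : ℂ) ≠ 0 := c.ne_zero
  have hd : (a : ℂ) * c * x * (c * y) - a * c * (x * y + 1) * c = -(a * c ^ 2) := by ring
  simp only [Matrix.det_fin_two_of, Matrix.of_apply, Matrix.cons_val', Matrix.cons_val_zero,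
    Matrix.cons_val_one, Matrix.cons_val_fin_one]
  rw [hd]
  congr 2
  · field_simp
  · field_simp

lemma relBessel_eq_zero (μ : ℂ) (m : ℤ) (lam : ℂ) {g : G} (hg : g ∉ U) :
    relBessel μ m lam g = 0 := if_neg hg

/-! ### Test functions -/

open Classical in
/-- `f` as a function of the four matrix entries (zero at singular matrices). -/
def inEntries (f : G → ℂ) (M : Fin 2 → Fin 2 → ℂ) : ℂ :=
  if h : (Matrix.of M).det ≠ 0 then
    f (Matrix.GeneralLinearGroup.mkOfDetNeZero (Matrix.of M) h)
  else 0

/-- `f ∈ C_c^∞(G)`: `f` is compactly supported in `G` and, `G` being an open subset of the space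
of complex matrices, (real) smooth in the matrix entries. -/
def IsTestFunction (f : G → ℂ) : Prop :=
  HasCompactSupport f ∧
    ContDiffOn ℝ ∞ (inEntries f) {M | (Matrix.of M).det ≠ 0}

end RelBessel

end

noncomputable section

namespace RelBessel

/-! ### The entire function underlying the Bessel functions -/

/-! The function $i$ is not merely locally integrable but locally bounded. On $U$ the coordinate
$x=-g_{11}g_{21}/\det g$ extends continuously to all of $G$, and the factors $\psi(y)$ and
$e(\mathrm{Tr}(\lambda/2x))$ have modulus one. So it suffices to bound $|\lambda/2x|\,\boldsymbol
J(\lambda^2/16x^2)$ for $0<|x|\le X$. With $z=\lambda^2/16x^2$ one has $|\lambda/2x|=2\sqrt{|z|}$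
and $|z|$ bounded below, and the whole matter is the estimate $\boldsymbol J(z)=O(|z|^{-1/2})$ away
from $0$ (`exists_norm_boldJ_le`).

For generic order, put $w=4\pi\sqrt z$. By `boldJGeneric_eq`, $\boldsymbol J(z)$ is a combination of
$K_\nu(-iw)K_{\nu'}(-i\bar w)$ and $K_\nu(iw)K_{\nu'}(i\bar w)$ with $\nu,\nu'=2\mu\pm m/2$; the
mixed products, one of which may grow exponentially, cancel because $m$ is an integer. In the
surviving products the exponential factors of $w$ and $\bar w$ are reciprocal, so only $|w|^{-1}$
remains.

This needs $K_\nu(\zeta)=O(|\zeta|^{-1/2}|e^{-\zeta}|)$ up to and including $|\arg\zeta|=\pi$. On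
the positive axis it follows from $2K_\nu(2e^s)=\int e^{\nu t-2e^s\cosh t}\,dt$ and a Gaussian
majorant; `connection_formula` identifies this integral with the combination of power series that
continues to complex $s$. From the axis one moves vertically in $s=\log(\zeta/2)$ with an energy
inequality (`besselEnergy_le`), whose only unbounded term has the favourable sign.

All bounds are locally uniform in generic orders, so a removable singularity argument carries them
to the nongeneric orders, where $\boldsymbol J$ is defined as a limit (`tendsto_boldJGeneric`). -/

lemma exists_norm_inv_Gamma_le (R : ℝ) :
    ∃ C : ℝ, ∀ ν : ℂ, ‖ν‖ ≤ R → ∀ k : ℕ, ‖(Complex.Gamma (ν + k + 1))⁻¹‖ ≤ C := by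
  have hloc : ∀ k : ℕ, ∃ C : ℝ, ∀ ν : ℂ, ‖ν‖ ≤ R → ‖(Complex.Gamma (ν + k + 1))⁻¹‖ ≤ C := by
    intro k
    have hc : Continuous fun ν : ℂ => (Complex.Gamma (ν + k + 1))⁻¹ :=
      Complex.differentiable_one_div_Gamma.continuous.comp (by fun_prop)
    obtain ⟨C, hC⟩ := (isCompact_closedBall (0 : ℂ) R).exists_bound_of_continuousOn
      hc.continuousOn
    exact ⟨C, fun ν hν => hC ν (by simpa using hν)⟩
  choose C hC using hloc
  -- For $k\ge n\ge R$ one has $|\nu+k+1|\ge1$, so $1/\Gamma(s)=s/\Gamma(s+1)$ shows that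
  -- $|1/\Gamma(\nu+k+1)|$ does not increase with $k$. Only the finitely many $k\le n$ need
  -- compactness.
  obtain ⟨n, hn⟩ := exists_nat_ge R
  refine ⟨∑ k ∈ Finset.range (n + 1), |C k|, fun ν hν k => ?_⟩
  have hle : ∀ k ≤ n, ‖(Complex.Gamma (ν + k + 1))⁻¹‖ ≤ ∑ k ∈ Finset.range (n + 1), |C k| := by
    intro k hk
    refine (hC k ν hν).trans ((le_abs_self _).trans ?_)
    exact Finset.single_le_sum (f := fun k => |C k|) (fun i _ => abs_nonneg _)
      (Finset.mem_range.2 (by omega))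
  induction k with
  | zero => exact hle 0 (Nat.zero_le _)
  | succ k ih =>
    rcases Nat.lt_or_ge k n with hk | hk
    · exact hle (k + 1) hk
    · rw [Complex.one_div_Gamma_eq_self_mul_one_div_Gamma_add_one (ν + k + 1)] at ih
      push_cast
      rw [← add_assoc, norm_mul] at *
      refine le_trans (le_mul_of_one_le_left (norm_nonneg _) ?_) ih
      have h1 : ‖((k + 1 : ℝ) : ℂ)‖ ≤ ‖ν + k + 1‖ + ‖ν‖ := by
        have : ((k + 1 : ℝ) : ℂ) = (ν + k + 1) - ν := by push_cast; ring
        rw [this]; exact norm_sub_le _ _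
      rw [Complex.norm_real, Real.norm_of_nonneg (by positivity)] at h1
      have : (n : ℝ) ≤ k := by exact_mod_cast hk
      linarith

/-- The entire function `∑ x ^ k / (k! Γ(ν + k + 1))`. -/
def besselSeries (ν x : ℂ) : ℂ :=
  ∑' k : ℕ, x ^ k / ((k.factorial : ℂ) * Complex.Gamma (ν + k + 1))

lemma norm_besselSeries_term_le {R C r : ℝ} (hr : 0 ≤ r)
    (hC : ∀ ν : ℂ, ‖ν‖ ≤ R → ∀ k : ℕ, ‖(Complex.Gamma (ν + k + 1))⁻¹‖ ≤ C) {ν x : ℂ}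
    (hν : ‖ν‖ ≤ R) (hx : ‖x‖ ≤ r) (k : ℕ) :
    ‖x ^ k / ((k.factorial : ℂ) * Complex.Gamma (ν + k + 1))‖ ≤ r ^ k / k.factorial * C := by
  rw [div_mul_eq_div_div, div_eq_mul_inv _ (Complex.Gamma _), norm_mul, norm_div, norm_pow,
    Complex.norm_natCast]
  gcongr
  exact hC ν hν k

lemma summable_besselSeries (ν x : ℂ) :
    Summable fun k : ℕ => x ^ k / ((k.factorial : ℂ) * Complex.Gamma (ν + k + 1)) := by
  obtain ⟨C, hC⟩ := exists_norm_inv_Gamma_le ‖ν‖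
  exact Summable.of_norm_bounded ((Real.summable_pow_div_factorial ‖x‖).mul_right C)
    fun k => norm_besselSeries_term_le (norm_nonneg x) hC le_rfl le_rfl k

lemma hasDerivAt_besselSeries (ν x : ℂ) :
    HasDerivAt (besselSeries ν) (besselSeries (ν + 1) x) x := by
  obtain ⟨C, hC⟩ := exists_norm_inv_Gamma_le (‖ν‖ + 1)
  have hν : ‖ν + 1‖ ≤ ‖ν‖ + 1 := (norm_add_le _ _).trans (by simp)
  set r : ℝ := ‖x‖ + 1 with hr
  have hr0 : 0 ≤ r := by positivity
  set g' : ℕ → ℂ → ℂ := fun k y => (k * y ^ (k - 1)) /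
    ((k.factorial : ℂ) * Complex.Gamma (ν + k + 1))
  have hsucc : ∀ (k : ℕ) (y : ℂ), g' (k + 1) y =
      y ^ k / ((k.factorial : ℂ) * Complex.Gamma (ν + 1 + k + 1)) := by
    intro k y
    have hk : ((k : ℂ) + 1) ≠ 0 := by exact_mod_cast k.succ_ne_zero
    simp only [g', Nat.factorial_succ]
    push_cast
    rw [show ν + ((k : ℂ) + 1) + 1 = ν + 1 + k + 1 by ring, mul_assoc,
      mul_div_mul_left _ _ hk]
  have hzero : ∀ y, g' 0 y = 0 := fun y => by simp [g']
  -- The differentiated series loses its zeroth term and is the series of order $\nu+1$ shifted by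
  -- one; the majorant is shifted in the same way.
  set u : ℕ → ℝ := fun k => k.casesOn 0 (fun j => r ^ j / j.factorial * C)
  have hu : Summable u := by
    rw [← summable_nat_add_iff 1]
    exact (Real.summable_pow_div_factorial r).mul_right C
  have key := hasDerivAt_tsum_of_isPreconnected (𝕜 := ℂ)
    (g := fun (k : ℕ) (y : ℂ) => y ^ k / ((k.factorial : ℂ) * Complex.Gamma (ν + k + 1)))
    (g' := g') (t := Metric.ball 0 r) (y₀ := x) (y := x) hu
    Metric.isOpen_ball (convex_ball _ _).isPreconnected
    (fun k y _ => (hasDerivAt_pow k y).div_const _) (fun k y hy => ?_)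
    (by simp [hr]) (summable_besselSeries ν x) (by simp [hr])
  · have hs : Summable fun k => g' k x := by
      rw [← summable_nat_add_iff 1]
      simpa only [hsucc] using summable_besselSeries (ν + 1) x
    rw [hs.tsum_eq_zero_add, hzero, zero_add] at key
    simp only [hsucc] at key
    exact key
  · cases k with
    | zero => simp [hzero, u]
    | succ k =>
      rw [hsucc]
      exact norm_besselSeries_term_le hr0 hC hν (by simpa using (Metric.mem_ball.1 hy).le) k

lemma continuous_besselSeries (ν : ℂ) : Continuous (besselSeries ν) :=
  continuous_iff_continuousAt.2 fun x => (hasDerivAt_besselSeries ν x).continuousAt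

lemma differentiable_besselSeries_order (x : ℂ) : Differentiable ℂ fun ν => besselSeries ν x := by
  intro ν
  obtain ⟨C, hC⟩ := exists_norm_inv_Gamma_le (‖ν‖ + 1)
  have h : DifferentiableOn ℂ (fun ν => besselSeries ν x) (Metric.ball 0 (‖ν‖ + 1)) := by
    refine Complex.differentiableOn_tsum_of_summable_norm
      ((Real.summable_pow_div_factorial ‖x‖).mul_right C) (fun k => ?_) Metric.isOpen_ball
      fun k w hw => norm_besselSeries_term_le (norm_nonneg x) hC
        (by simpa using (Metric.mem_ball.1 hw).le) le_rfl k
    simp only [div_mul_eq_div_div, div_eq_mul_inv _ (Complex.Gamma _)]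
    exact ((Complex.differentiable_one_div_Gamma.comp (by fun_prop)).const_mul _).differentiableOn
  exact h.differentiableAt (Metric.isOpen_ball.mem_nhds (by simp))

/-- Coefficientwise this is $1/\Gamma(\nu+k)=(\nu+k)/\Gamma(\nu+k+1)$: the $k$-part, after an index
shift, is the term of order $\nu+1$. -/
lemma besselSeries_recurrence (ν x : ℂ) :
    x * besselSeries (ν + 1) x + ν * besselSeries ν x = besselSeries (ν - 1) x := by
  have h1 := (summable_besselSeries (ν + 1) x).mul_left x
  have h0 := (summable_besselSeries ν x).mul_left ν
  have hΓ := Complex.one_div_Gamma_eq_self_mul_one_div_Gamma_add_one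
  have hsum : Summable fun k : ℕ => (k * x ^ k) / ((k.factorial : ℂ) * Complex.Gamma (ν + k + 1)) :=
    by
    rw [← summable_nat_add_iff 1]
    refine h1.congr fun k => ?_
    have hk : ((k : ℂ) + 1) ≠ 0 := by exact_mod_cast k.succ_ne_zero
    rw [Nat.factorial_succ]
    push_cast
    rw [show ν + ((k : ℂ) + 1) + 1 = ν + 1 + k + 1 by ring, mul_assoc, mul_div_mul_left _ _ hk]
    ring
  have hx : x * besselSeries (ν + 1) x =
      ∑' k : ℕ, (k * x ^ k) / ((k.factorial : ℂ) * Complex.Gamma (ν + k + 1)) := by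
    rw [hsum.tsum_eq_zero_add, besselSeries, ← tsum_mul_left]
    simp only [Nat.cast_zero, zero_mul, zero_div, zero_add]
    refine tsum_congr fun k => ?_
    have hk : ((k : ℂ) + 1) ≠ 0 := by exact_mod_cast k.succ_ne_zero
    rw [Nat.factorial_succ]
    push_cast
    rw [show ν + ((k : ℂ) + 1) + 1 = ν + 1 + k + 1 by ring, mul_assoc, mul_div_mul_left _ _ hk]
    ring
  rw [hx, besselSeries, ← tsum_mul_left, ← hsum.tsum_add h0, besselSeries]
  refine tsum_congr fun k => ?_
  have := hΓ (ν + k)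
  simp only [div_mul_eq_div_div, div_eq_mul_inv _ (Complex.Gamma _)]
  rw [show ν - 1 + k + 1 = ν + k by ring, this]
  ring

lemma besselSeries_zero (ν : ℂ) : besselSeries ν 0 = (Complex.Gamma (ν + 1))⁻¹ := by
  rw [besselSeries, tsum_eq_single 0 (fun k hk => by simp [hk])]
  simp

/-! ### The modified Bessel function in the logarithmic variable -/

/-- `I_ν(2 e^s)`, an entire function of `ν` and of `s`. -/
def besselI (ν s : ℂ) : ℂ := Complex.exp (ν * s) * besselSeries ν (Complex.exp (2 * s))

lemma differentiable_besselI_order (s : ℂ) : Differentiable ℂ fun ν => besselI ν s :=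
  Differentiable.mul (by fun_prop) (differentiable_besselSeries_order _)

lemma hasDerivAt_besselI_succ (ν s : ℂ) :
    HasDerivAt (besselI ν) (ν * besselI ν s + 2 * Complex.exp s * besselI (ν + 1) s) s := by
  have h2 : HasDerivAt (fun s : ℂ => Complex.exp (2 * s)) (Complex.exp (2 * s) * 2) s := by
    simpa using ((hasDerivAt_id s).const_mul (2 : ℂ)).cexp
  have h1 : HasDerivAt (fun s : ℂ => Complex.exp (ν * s)) (Complex.exp (ν * s) * ν) s := by
    simpa using ((hasDerivAt_id s).const_mul ν).cexp
  convert! h1.mul ((hasDerivAt_besselSeries ν _).comp s h2) using 1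
  simp only [besselI, Function.comp_def]
  rw [add_mul ν, Complex.exp_add, two_mul s, Complex.exp_add]
  ring_nf

lemma hasDerivAt_besselI_pred (ν s : ℂ) :
    HasDerivAt (besselI ν) (-ν * besselI ν s + 2 * Complex.exp s * besselI (ν - 1) s) s := by
  convert! hasDerivAt_besselI_succ ν s using 1
  simp only [besselI]
  rw [← besselSeries_recurrence, add_mul ν, sub_mul ν, Complex.exp_add, Complex.exp_sub,
    one_mul, two_mul s, Complex.exp_add]
  have := Complex.exp_ne_zero s
  field_simp
  ring

/-! ### The integral representation of the Macdonald function -/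

/-- Since $\cosh t=1+2\sinh^2(t/2)$. This replaces $e^{-b(\cosh t-1)}$ by a Gaussian, whose integral
gives the decay $b^{-1/2}$. -/
lemma one_add_sq_div_two_le_cosh (t : ℝ) : 1 + t ^ 2 / 2 ≤ Real.cosh t := by
  have h : Real.cosh t = 1 + 2 * Real.sinh (|t| / 2) ^ 2 := by
    have := Real.cosh_two_mul (|t| / 2)
    rw [mul_div_cancel₀ _ two_ne_zero, Real.cosh_abs] at this
    rw [this, Real.cosh_sq]; ring
  have h2 : (|t| / 2) ^ 2 ≤ Real.sinh (|t| / 2) ^ 2 := by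
    have := Real.self_le_sinh_iff.2 (show 0 ≤ |t| / 2 by positivity)
    gcongr
  rw [div_pow, sq_abs] at h2
  rw [h]; linarith

/-- `2 K_ν(2 e^s)`, `s` real, as an integral over the real line. -/
def besselKInt (ν : ℂ) (s : ℝ) : ℂ :=
  ∫ t : ℝ, Complex.exp (ν * t - ((2 * Real.exp s * Real.cosh t : ℝ) : ℂ))

lemma norm_cexp_mul_sub (ν : ℂ) (t b : ℝ) :
    ‖Complex.exp (ν * t - (b : ℂ))‖ = Real.exp (ν.re * t - b) := by
  rw [Complex.norm_exp]; simp

lemma integrable_exp_mul_sub_sq (a : ℝ) {b : ℝ} (hb : 0 < b) :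
    Integrable fun t : ℝ => Real.exp (a * t - b * t ^ 2) := by
  have := (integrable_cexp_quadratic (b := (b : ℂ)) (by simpa using hb) (a : ℂ) 0).norm
  refine this.congr (ae_of_all _ fun t => ?_)
  simp only [Complex.norm_exp]
  congr 1
  norm_cast
  ring

lemma integral_exp_mul_sub_sq (a : ℝ) {b : ℝ} (hb : 0 < b) :
    ∫ t : ℝ, Real.exp (a * t - b * t ^ 2) = √(Real.pi / b) * Real.exp (a ^ 2 / (4 * b)) := by
  have h : ∀ t : ℝ, Real.exp (a * t - b * t ^ 2) =
      Real.exp (a ^ 2 / (4 * b)) * Real.exp (-b * (t - a / (2 * b)) ^ 2) := by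
    intro t
    rw [← Real.exp_add]
    congr 1
    field_simp
    ring
  simp_rw [h]
  rw [integral_const_mul, integral_sub_right_eq_self (fun t => Real.exp (-b * t ^ 2)),
    integral_gaussian, mul_comm]

lemma integrable_exp_abs_sub_cosh (a : ℝ) {b : ℝ} (hb : 0 < b) :
    Integrable fun t : ℝ => Real.exp (a * |t| - b * Real.cosh t) := by
  have h := (integrable_exp_mul_sub_sq a (half_pos hb)).add
    (integrable_exp_mul_sub_sq (-a) (half_pos hb))
  refine h.mono' (by fun_prop) (ae_of_all _ fun t => ?_)
  rw [Real.norm_of_nonneg (Real.exp_pos _).le]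
  have hc := one_add_sq_div_two_le_cosh t
  have hle : ∀ x : ℝ, Real.exp (x - b * Real.cosh t) ≤ Real.exp (x - b / 2 * t ^ 2) := by
    intro x
    refine Real.exp_le_exp.2 ?_
    nlinarith
  refine (hle _).trans ?_
  rcases abs_cases t with ⟨h1, _⟩ | ⟨h1, _⟩ <;> rw [h1]
  · exact le_add_of_nonneg_right (Real.exp_pos _).le
  · rw [show a * -t = -a * t by ring]
    exact le_add_of_nonneg_left (Real.exp_pos _).le

lemma norm_cexp_mul_sub_le (ν : ℂ) (t b : ℝ) :
    ‖Complex.exp (ν * t - (b : ℂ))‖ ≤ Real.exp (‖ν‖ * |t| - b) := by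
  rw [norm_cexp_mul_sub]
  refine Real.exp_le_exp.2 (sub_le_sub_right ((le_abs_self _).trans ?_) b)
  rw [abs_mul]
  gcongr
  exact Complex.abs_re_le_norm ν

lemma integrable_besselKInt (ν : ℂ) (s : ℝ) :
    Integrable fun t : ℝ => Complex.exp (ν * t - ((2 * Real.exp s * Real.cosh t : ℝ) : ℂ)) := by
  refine (integrable_exp_abs_sub_cosh ‖ν‖ (b := 2 * Real.exp s) (by positivity)).mono'
    (by fun_prop) (ae_of_all _ fun t => norm_cexp_mul_sub_le _ _ _)

lemma differentiable_besselKInt_order (s : ℝ) : Differentiable ℂ fun ν => besselKInt ν s := by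
  intro ν₀
  have h := hasDerivAt_integral_of_dominated_loc_of_deriv_le (μ := volume)
    (F := fun (ν : ℂ) (t : ℝ) =>
      Complex.exp (ν * t - ((2 * Real.exp s * Real.cosh t : ℝ) : ℂ)))
    (F' := fun (ν : ℂ) (t : ℝ) =>
      Complex.exp (ν * t - ((2 * Real.exp s * Real.cosh t : ℝ) : ℂ)) * t)
    -- One unit covers the radius of the ball of orders, the other absorbs the factor $|t|\le
    -- e^{|t|}$ produced by differentiation.
    (bound := fun t => Real.exp ((‖ν₀‖ + 2) * |t| - 2 * Real.exp s * Real.cosh t))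
    (x₀ := ν₀) (Metric.ball_mem_nhds ν₀ one_pos)
    (Eventually.of_forall fun ν => (integrable_besselKInt ν s).aestronglyMeasurable)
    (integrable_besselKInt ν₀ s) (by fun_prop)
    (ae_of_all _ fun t ν hν => ?_)
    (integrable_exp_abs_sub_cosh (‖ν₀‖ + 2) (b := 2 * Real.exp s) (by positivity))
    (ae_of_all _ fun t ν hν => ?_)
  · exact h.2.differentiableAt
  · have hν' : ‖ν‖ ≤ ‖ν₀‖ + 1 := by
      have := norm_le_norm_add_norm_sub' ν ν₀
      have h2 := (mem_ball_iff_norm.1 hν).le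
      linarith
    rw [norm_mul, Complex.norm_real, Real.norm_eq_abs]
    calc _ ≤ Real.exp ((‖ν₀‖ + 1) * |t| - 2 * Real.exp s * Real.cosh t) * Real.exp |t| := by
          gcongr
          · refine (norm_cexp_mul_sub_le _ _ _).trans ?_
            gcongr
          · linarith [Real.add_one_le_exp |t|]
      _ = _ := by rw [← Real.exp_add]; congr 1; ring
  · simpa using (((hasDerivAt_id ν).mul_const (t : ℂ)).sub_const
      ((2 * Real.exp s * Real.cosh t : ℝ) : ℂ)).cexp

lemma besselKInt_neg (ν : ℂ) (s : ℝ) : besselKInt (-ν) s = besselKInt ν s := by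
  rw [besselKInt, ← integral_neg_eq_self]
  simp [besselKInt]

lemma cexp_mul_cosh (ν : ℂ) (t b : ℝ) :
    Complex.exp (ν * t - b) * ((2 * Real.cosh t : ℝ) : ℂ) =
      Complex.exp ((ν + 1) * t - b) + Complex.exp ((ν - 1) * t - b) := by
  rw [show (ν + 1) * t - b = (ν * t - b) + t by ring,
    show (ν - 1) * t - b = (ν * t - b) + -t by ring, Complex.exp_add, Complex.exp_add]
  push_cast
  rw [Complex.cosh]
  ring

lemma cexp_mul_sinh (ν : ℂ) (t b : ℝ) :
    Complex.exp (ν * t - b) * ((2 * Real.sinh t : ℝ) : ℂ) =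
      Complex.exp ((ν + 1) * t - b) - Complex.exp ((ν - 1) * t - b) := by
  rw [show (ν + 1) * t - b = (ν * t - b) + t by ring,
    show (ν - 1) * t - b = (ν * t - b) + -t by ring, Complex.exp_add, Complex.exp_add]
  push_cast
  rw [Complex.sinh]
  ring

lemma integral_cosh_besselKInt (ν : ℂ) (s : ℝ) :
    ∫ t : ℝ, Complex.exp (ν * t - ((2 * Real.exp s * Real.cosh t : ℝ) : ℂ)) *
      ((2 * Real.cosh t : ℝ) : ℂ) = besselKInt (ν + 1) s + besselKInt (ν - 1) s := by
  simp_rw [cexp_mul_cosh]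
  exact integral_add (integrable_besselKInt _ _) (integrable_besselKInt _ _)

lemma hasDerivAt_besselKInt_aux (ν : ℂ) (s₀ : ℝ) :
    HasDerivAt (besselKInt ν)
      (-(Real.exp s₀ * (besselKInt (ν + 1) s₀ + besselKInt (ν - 1) s₀))) s₀ := by
  have h := hasDerivAt_integral_of_dominated_loc_of_deriv_le (μ := volume) (𝕜 := ℝ)
    (F := fun (s : ℝ) (t : ℝ) =>
      Complex.exp (ν * t - ((2 * Real.exp s * Real.cosh t : ℝ) : ℂ)))
    (F' := fun (s : ℝ) (t : ℝ) => -Real.exp s *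
      (Complex.exp (ν * t - ((2 * Real.exp s * Real.cosh t : ℝ) : ℂ)) *
        ((2 * Real.cosh t : ℝ) : ℂ)))
    -- On the unit ball around $s_0$ the prefactor is largest at $s_0+1$ and the decay weakest at
    -- $s_0-1$; the extra $|t|$ in the exponent pays for $\cosh t\le e^{|t|}$.
    (bound := fun t => 2 * Real.exp (s₀ + 1) *
      Real.exp ((‖ν‖ + 1) * |t| - 2 * Real.exp (s₀ - 1) * Real.cosh t))
    (x₀ := s₀) (Metric.ball_mem_nhds s₀ one_pos)
    (Eventually.of_forall fun s => (integrable_besselKInt ν s).aestronglyMeasurable)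
    (integrable_besselKInt ν s₀) (by fun_prop)
    (ae_of_all _ fun t s hs => ?_)
    ((integrable_exp_abs_sub_cosh (‖ν‖ + 1) (b := 2 * Real.exp (s₀ - 1))
      (by positivity)).const_mul _)
    (ae_of_all _ fun t s hs => ?_)
  · convert! h.2 using 1
    rw [integral_const_mul, integral_cosh_besselKInt]
    ring
  · rw [Metric.mem_ball, Real.dist_eq, abs_lt] at hs
    have hcosh : Real.cosh t ≤ Real.exp |t| := by
      rw [← Real.cosh_abs, Real.cosh_eq]
      have : Real.exp (-|t|) ≤ Real.exp |t| := by gcongr; linarith [abs_nonneg t]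
      linarith
    rw [norm_mul, norm_mul, norm_neg, Complex.norm_real, Complex.norm_real,
      Real.norm_of_nonneg (Real.exp_pos _).le,
      Real.norm_of_nonneg (by have := Real.cosh_pos t; positivity)]
    calc _ ≤ Real.exp (s₀ + 1) * (Real.exp (‖ν‖ * |t| - 2 * Real.exp (s₀ - 1) * Real.cosh t) *
          (2 * Real.exp |t|)) := by
          have := Real.cosh_pos t
          gcongr
          · linarith
          · refine (norm_cexp_mul_sub_le _ _ _).trans ?_
            gcongr
            linarith
      _ = _ := by
        rw [add_mul, one_mul, add_sub_right_comm, Real.exp_add _ |t|]; ring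
  · have h1 : HasDerivAt (fun s : ℝ => 2 * Real.exp s * Real.cosh t)
        (2 * Real.exp s * Real.cosh t) s :=
      ((Real.hasDerivAt_exp s).const_mul 2).mul_const _
    convert! (h1.ofReal_comp.const_sub (ν * t)).cexp using 1
    push_cast
    ring

/-- The integral over $\mathbb R$ of the $t$-derivative of the integrand vanishes. -/
lemma besselKInt_recurrence (ν : ℂ) (s : ℝ) :
    ν * besselKInt ν s = Real.exp s * (besselKInt (ν + 1) s - besselKInt (ν - 1) s) := by
  have hint : Integrable fun t : ℝ =>
      Complex.exp (ν * t - ((2 * Real.exp s * Real.cosh t : ℝ) : ℂ)) *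
        ((2 * Real.sinh t : ℝ) : ℂ) := by
    simp_rw [cexp_mul_sinh]
    exact (integrable_besselKInt _ _).sub (integrable_besselKInt _ _)
  have h := integral_eq_zero_of_hasDerivAt_of_integrable
    (f := fun t : ℝ => Complex.exp (ν * t - ((2 * Real.exp s * Real.cosh t : ℝ) : ℂ)))
    (f' := fun t : ℝ =>
      ν * Complex.exp (ν * t - ((2 * Real.exp s * Real.cosh t : ℝ) : ℂ)) -
      Real.exp s * (Complex.exp (ν * t - ((2 * Real.exp s * Real.cosh t : ℝ) : ℂ)) *
        ((2 * Real.sinh t : ℝ) : ℂ)))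
    (fun t => ?_) (((integrable_besselKInt ν s).const_mul _).sub (hint.const_mul _))
    (integrable_besselKInt ν s)
  · rw [integral_sub ((integrable_besselKInt ν s).const_mul _) (hint.const_mul _),
      integral_const_mul, integral_const_mul, sub_eq_zero] at h
    simp_rw [cexp_mul_sinh] at h
    rw [integral_sub (integrable_besselKInt _ _) (integrable_besselKInt _ _)] at h
    exact h
  · have h1 : HasDerivAt (fun t : ℝ => 2 * Real.exp s * Real.cosh t)
        (2 * Real.exp s * Real.sinh t) t := (Real.hasDerivAt_cosh t).const_mul _
    have h2 : HasDerivAt (fun t : ℝ => ν * (t : ℂ)) ν t := by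
      simpa using ((hasDerivAt_id t).ofReal_comp).const_mul ν
    convert! (h2.sub h1.ofReal_comp).cexp using 1
    simp only [Pi.sub_apply]
    push_cast
    ring

lemma hasDerivAt_besselKInt_pred (ν : ℂ) (s : ℝ) :
    HasDerivAt (besselKInt ν)
      (-ν * besselKInt ν s - 2 * Real.exp s * besselKInt (ν - 1) s) s := by
  convert! hasDerivAt_besselKInt_aux ν s using 1
  rw [neg_mul, besselKInt_recurrence]
  ring

lemma hasDerivAt_besselKInt_succ (ν : ℂ) (s : ℝ) :
    HasDerivAt (besselKInt ν)
      (ν * besselKInt ν s - 2 * Real.exp s * besselKInt (ν + 1) s) s := by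
  convert! hasDerivAt_besselKInt_aux ν s using 1
  rw [besselKInt_recurrence]
  ring

/-! ### Bounds on the real line -/

lemma integral_exp_sub_cosh_le (a : ℝ) {b : ℝ} (hb : 0 < b) {F : ℝ → ℂ}
    (hF : ∀ t, ‖F t‖ ≤ Real.exp (a * t - b * (Real.cosh t - 1))) :
    ‖∫ t, F t‖ ≤ √(2 * Real.pi / b) * Real.exp (a ^ 2 / (2 * b)) := by
  have h := norm_integral_le_of_norm_le (f := F)
    (integrable_exp_mul_sub_sq a (half_pos hb)) (ae_of_all _ fun t => ?_)
  · rw [integral_exp_mul_sub_sq a (half_pos hb)] at h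
    convert h using 3
    · field_simp
    · field_simp
      norm_num
  · refine (hF t).trans (Real.exp_le_exp.2 ?_)
    have := one_add_sq_div_two_le_cosh t
    nlinarith

lemma norm_besselKInt_le (ν : ℂ) (s : ℝ) :
    ‖Complex.exp (2 * Real.exp s) * besselKInt ν s‖ ≤
      √(2 * Real.pi / Real.exp s) * Real.exp (ν.re ^ 2 / (2 * Real.exp s)) := by
  rw [besselKInt, ← integral_const_mul]
  -- The available decay rate is $2e^s$, of which only $e^s$ is used, so that the bound has the same
  -- shape as the one for the derivative.
  refine integral_exp_sub_cosh_le ν.re (Real.exp_pos s) fun t => ?_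
  rw [norm_mul, norm_cexp_mul_sub, Complex.norm_exp, ← Real.exp_add]
  gcongr
  have := Real.one_le_cosh t
  have := Real.exp_pos s
  norm_cast
  nlinarith

/-- Bounding the two terms separately would lose a factor $e^s$. Under the integral they combine to
$2e^s(1-\cosh t)=-2y$, and $2y\le e^y$ is absorbed by half of the decay $e^{-2y}$. -/
lemma norm_besselKInt_deriv_le (ν : ℂ) (s : ℝ) :
    ‖Complex.exp (2 * Real.exp s) * (2 * Real.exp s * besselKInt ν s -
        Real.exp s * (besselKInt (ν + 1) s + besselKInt (ν - 1) s))‖ ≤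
      √(2 * Real.pi / Real.exp s) * Real.exp (ν.re ^ 2 / (2 * Real.exp s)) := by
  have hint : Integrable fun t : ℝ =>
      Complex.exp (ν * t - ((2 * Real.exp s * Real.cosh t : ℝ) : ℂ)) *
        ((2 * Real.cosh t : ℝ) : ℂ) := by
    simp_rw [cexp_mul_cosh]
    exact (integrable_besselKInt _ _).add (integrable_besselKInt _ _)
  rw [← integral_cosh_besselKInt, besselKInt, ← integral_const_mul, ← integral_const_mul,
    ← integral_sub ((integrable_besselKInt ν s).const_mul _) (hint.const_mul _),
    ← integral_const_mul]
  refine integral_exp_sub_cosh_le ν.re (Real.exp_pos s) fun t => ?_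
  have hfac : Complex.exp (2 * Real.exp s) *
      (2 * Real.exp s * Complex.exp (ν * t - ((2 * Real.exp s * Real.cosh t : ℝ) : ℂ)) -
        Real.exp s * (Complex.exp (ν * t - ((2 * Real.exp s * Real.cosh t : ℝ) : ℂ)) *
          ((2 * Real.cosh t : ℝ) : ℂ))) =
      -(((2 * Real.exp s * (Real.cosh t - 1) : ℝ) : ℂ) * (Complex.exp ((2 * Real.exp s : ℝ) : ℂ) *
        Complex.exp (ν * t - ((2 * Real.exp s * Real.cosh t : ℝ) : ℂ)))) := by
    push_cast
    ring
  have h1 := Real.one_le_cosh t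
  have h2 := Real.exp_pos s
  set y : ℝ := Real.exp s * (Real.cosh t - 1) with hy
  have hy0 : 0 ≤ y := mul_nonneg h2.le (by linarith)
  rw [hfac, norm_neg, norm_mul, norm_mul, norm_cexp_mul_sub, Complex.norm_exp,
    ← Real.exp_add, Complex.norm_real, Real.norm_of_nonneg (by nlinarith), Complex.ofReal_re]
  have h3 : 2 * y ≤ Real.exp y := by
    have := Real.quadratic_le_exp_of_nonneg hy0
    nlinarith [sq_nonneg (y - 1)]
  calc _ ≤ Real.exp y * Real.exp (2 * Real.exp s + (ν.re * t - 2 * Real.exp s * Real.cosh t)) := by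
        gcongr
        linarith
    _ = _ := by rw [← Real.exp_add]; congr 1; rw [hy]; ring

/-! ### Behaviour at the origin -/

lemma integrable_and_integral_Gamma {ν : ℂ} (hν : 0 < ν.re) :
    Integrable (fun t : ℝ => Complex.exp (ν * t - ((Real.exp t : ℝ) : ℂ))) ∧
      ∫ t : ℝ, Complex.exp (ν * t - ((Real.exp t : ℝ) : ℂ)) = Complex.Gamma ν := by
  have himg : Real.exp '' Set.univ = Set.Ioi 0 := by rw [Set.image_univ, Real.range_exp]
  have hd : ∀ x ∈ Set.univ, HasDerivWithinAt Real.exp (Real.exp x) Set.univ x :=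
    fun x _ => (Real.hasDerivAt_exp x).hasDerivWithinAt
  have heq : ∀ t : ℝ, |Real.exp t| • ((Real.exp (-Real.exp t) : ℂ) *
      ((Real.exp t : ℝ) : ℂ) ^ (ν - 1)) =
      Complex.exp (ν * t - ((Real.exp t : ℝ) : ℂ)) := by
    intro t
    rw [abs_of_pos (Real.exp_pos t), Complex.real_smul,
      Complex.cpow_def_of_ne_zero (by exact_mod_cast (Real.exp_pos t).ne'),
      ← Complex.ofReal_log (Real.exp_pos t).le, Real.log_exp]
    push_cast
    rw [← Complex.exp_add, ← Complex.exp_add]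
    congr 1
    ring
  constructor
  · have h := Complex.GammaIntegral_convergent hν
    rw [← himg, integrableOn_image_iff_integrableOn_abs_deriv_smul MeasurableSet.univ hd
      Real.exp_injective.injOn, integrableOn_univ] at h
    simpa only [heq] using h
  · rw [Complex.Gamma_eq_integral hν, Complex.GammaIntegral, ← himg,
      integral_image_eq_integral_abs_deriv_smul MeasurableSet.univ hd Real.exp_injective.injOn,
      setIntegral_univ]
    exact integral_congr_ae (ae_of_all _ fun t => (heq t).symm)

/-- Translating $t$ by $s$ turns $2e^s\cosh t$ into $e^t+e^{2s-t}$. The second exponential dies as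
$s\to-\infty$, leaving Euler's integral, which also dominates. -/
lemma tendsto_besselKInt_atBot {ν : ℂ} (hν : 0 < ν.re) :
    Tendsto (fun s : ℝ => Complex.exp (ν * s) * besselKInt ν s) atBot
      (𝓝 (Complex.Gamma ν)) := by
  obtain ⟨hint, hval⟩ := integrable_and_integral_Gamma hν
  have heq : ∀ s : ℝ, Complex.exp (ν * s) * besselKInt ν s =
      ∫ t : ℝ, Complex.exp (ν * t - ((Real.exp t + Real.exp (2 * s - t) : ℝ) : ℂ)) := by
    intro s
    rw [besselKInt, ← integral_const_mul, ← integral_add_right_eq_self (fun t : ℝ =>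
      Complex.exp (ν * t - ((Real.exp t + Real.exp (2 * s - t) : ℝ) : ℂ))) s]
    refine integral_congr_ae (ae_of_all _ fun t => ?_)
    dsimp only
    rw [← Complex.exp_add]
    congr 1
    rw [Real.cosh_eq, show 2 * s - (t + s) = s + -t by ring, Real.exp_add, Real.exp_add]
    push_cast
    ring
  simp_rw [heq]
  rw [← hval]
  refine tendsto_integral_filter_of_dominated_convergence _
    (Eventually.of_forall fun s => by fun_prop) (Eventually.of_forall fun s =>
      ae_of_all _ fun t => ?_) hint.norm (ae_of_all _ fun t => ?_)
  · rw [norm_cexp_mul_sub, norm_cexp_mul_sub]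
    gcongr
    linarith [Real.exp_pos (2 * s - t)]
  · have h1 : Tendsto (fun s : ℝ => Real.exp (2 * s - t)) atBot (𝓝 0) :=
      Real.tendsto_exp_atBot.comp
        ((tendsto_id.const_mul_atBot two_pos).atBot_add (tendsto_const_nhds (x := -t)))
    have h2 : Tendsto (fun s : ℝ => Real.exp t + Real.exp (2 * s - t)) atBot
        (𝓝 (Real.exp t)) := by simpa using h1.const_add (Real.exp t)
    have hc : Continuous fun x : ℝ => Complex.exp (ν * t - (x : ℂ)) := by fun_prop
    exact (hc.tendsto _).comp h2

/-! ### The connection formula -/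

/-- The Wronskian of two solutions of the modified Bessel equation, written as a first order
system, is constant. -/
lemma wronskian_eq {ν : ℂ} {y₁ v₁ y₂ v₂ : ℝ → ℂ}
    (hy₁ : ∀ s, HasDerivAt y₁ (-ν * y₁ s + v₁ s) s)
    (hv₁ : ∀ s, HasDerivAt v₁ (ν * v₁ s + 4 * Real.exp s ^ 2 * y₁ s) s)
    (hy₂ : ∀ s, HasDerivAt y₂ (-ν * y₂ s + v₂ s) s)
    (hv₂ : ∀ s, HasDerivAt v₂ (ν * v₂ s + 4 * Real.exp s ^ 2 * y₂ s) s) {c : ℂ}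
    (hc : Tendsto (fun s => y₁ s * v₂ s - v₁ s * y₂ s) atBot (𝓝 c)) (s : ℝ) :
    y₁ s * v₂ s - v₁ s * y₂ s = c := by
  have hd : ∀ s, HasDerivAt (fun s => y₁ s * v₂ s - v₁ s * y₂ s) 0 s := by
    intro s
    convert! ((hy₁ s).mul (hv₂ s)).sub ((hv₁ s).mul (hy₂ s)) using 1
    ring
  have hconst : ∀ x, y₁ x * v₂ x - v₁ x * y₂ x = y₁ s * v₂ s - v₁ s * y₂ s :=
    fun x => is_const_of_deriv_eq_zero (fun x => (hd x).differentiableAt)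
      (fun x => (hd x).deriv) x s
  exact tendsto_nhds_unique (tendsto_const_nhds.congr fun x => (hconst x).symm) hc

/-- In this and the next two lemmas $K_\nu$, $I_\nu$ and $I_{-\nu}$ are put into one first order
system, with second component $v=y'+\nu y$, so that their Wronskians can be compared. -/
lemma hasDerivAt_system_besselKInt (ν : ℂ) (s : ℝ) :
    HasDerivAt (besselKInt ν)
      (-ν * besselKInt ν s + -(2 * Real.exp s * besselKInt (ν - 1) s)) s ∧
    HasDerivAt (fun s : ℝ => -(2 * Real.exp s * besselKInt (ν - 1) s))
      (ν * -(2 * Real.exp s * besselKInt (ν - 1) s) + 4 * Real.exp s ^ 2 * besselKInt ν s) s := by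
  refine ⟨by simpa [sub_eq_add_neg] using hasDerivAt_besselKInt_pred ν s, ?_⟩
  have h1 : HasDerivAt (fun s : ℝ => (2 * Real.exp s : ℂ)) (2 * Real.exp s) s :=
    (Real.hasDerivAt_exp s).ofReal_comp.const_mul 2
  convert! (h1.mul (hasDerivAt_besselKInt_succ (ν - 1) s)).neg using 1
  rw [sub_add_cancel]
  ring

lemma hasDerivAt_system_besselI (ν : ℂ) (s : ℝ) :
    HasDerivAt (fun s : ℝ => besselI ν s)
      (-ν * besselI ν s + 2 * Real.exp s * besselI (ν - 1) s) s ∧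
    HasDerivAt (fun s : ℝ => 2 * Real.exp s * besselI (ν - 1) s)
      (ν * (2 * Real.exp s * besselI (ν - 1) s) + 4 * Real.exp s ^ 2 * besselI ν s) s := by
  refine ⟨by simpa using (hasDerivAt_besselI_pred ν s).comp_ofReal, ?_⟩
  have h1 : HasDerivAt (fun s : ℝ => (2 * Real.exp s : ℂ)) (2 * Real.exp s) s :=
    (Real.hasDerivAt_exp s).ofReal_comp.const_mul 2
  convert! h1.mul (hasDerivAt_besselI_succ (ν - 1) s).comp_ofReal using 1
  rw [sub_add_cancel]
  push_cast
  ring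

lemma hasDerivAt_system_besselI_neg (ν : ℂ) (s : ℝ) :
    HasDerivAt (fun s : ℝ => besselI (-ν) s)
      (-ν * besselI (-ν) s + 2 * Real.exp s * besselI (1 - ν) s) s ∧
    HasDerivAt (fun s : ℝ => 2 * Real.exp s * besselI (1 - ν) s)
      (ν * (2 * Real.exp s * besselI (1 - ν) s) + 4 * Real.exp s ^ 2 * besselI (-ν) s) s := by
  refine ⟨by simpa [neg_add_eq_sub] using (hasDerivAt_besselI_succ (-ν) s).comp_ofReal, ?_⟩
  have h1 : HasDerivAt (fun s : ℝ => (2 * Real.exp s : ℂ)) (2 * Real.exp s) s :=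
    (Real.hasDerivAt_exp s).ofReal_comp.const_mul 2
  convert! h1.mul (hasDerivAt_besselI_pred (1 - ν) s).comp_ofReal using 1
  rw [show 1 - ν - 1 = -ν by ring]
  push_cast
  ring

lemma tendsto_besselSeries_exp_atBot (ν : ℂ) :
    Tendsto (fun s : ℝ => besselSeries ν (Complex.exp (2 * s))) atBot
      (𝓝 (Complex.Gamma (ν + 1))⁻¹) := by
  rw [← besselSeries_zero]
  refine ((continuous_besselSeries ν).tendsto 0).comp (Complex.tendsto_exp_nhds_zero_iff.2 ?_)
  simpa using tendsto_id.const_mul_atBot (two_pos (α := ℝ))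

lemma tendsto_cexp_mul_atBot {a : ℂ} (ha : 0 < a.re) :
    Tendsto (fun s : ℝ => Complex.exp (a * s)) atBot (𝓝 0) := by
  refine Complex.tendsto_exp_nhds_zero_iff.2 ?_
  simpa using tendsto_id.const_mul_atBot ha

/-- The three pairwise Wronskians are constant and are computed at $-\infty$; the reflection formula
for $\Gamma$ supplies the sine. The strip makes both $\operatorname{Re}\nu$ and
$\operatorname{Re}(1-\nu)$ positive, as the limits require. -/
lemma connection_formula_of_mem_strip {ν : ℂ} (h0 : 0 < ν.re) (h1 : ν.re < 1) (s : ℝ) :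
    Complex.sin (Real.pi * ν) / Real.pi * besselKInt ν s = besselI (-ν) s - besselI ν s := by
  have h1' : 0 < (1 - ν).re := by simpa using h1
  have hK := tendsto_besselKInt_atBot h0
  have hK' := tendsto_besselKInt_atBot h1'
  have hf := tendsto_besselSeries_exp_atBot
  have hΓ0 : Complex.Gamma ν ≠ 0 := Complex.Gamma_ne_zero_of_re_pos h0
  have hΓ1 : Complex.Gamma (1 - ν) ≠ 0 := Complex.Gamma_ne_zero_of_re_pos h1'
  have hsym : ∀ s : ℝ, besselKInt (ν - 1) s = besselKInt (1 - ν) s := fun s => by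
    rw [← besselKInt_neg]; congr 1; ring
  have hW1 : Tendsto (fun s : ℝ => besselKInt ν s * (2 * Real.exp s * besselI (ν - 1) s) -
      -(2 * Real.exp s * besselKInt (ν - 1) s) * besselI ν s) atBot (𝓝 2) := by
    have := ((hK.mul (hf (ν - 1))).const_mul 2).add
      (((tendsto_cexp_mul_atBot (a := 2 * ν) (by simpa using h0)).mul
        (hK'.mul (hf ν))).const_mul 2)
    rw [sub_add_cancel, mul_inv_cancel₀ hΓ0, zero_mul, mul_zero, add_zero, mul_one] at this
    refine this.congr fun s => ?_
    rw [hsym, besselI, besselI, Complex.ofReal_exp,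
      show 2 * ν * (s : ℂ) = ν * s + ν * s by ring, Complex.exp_add,
      show (ν - 1) * (s : ℂ) = ν * s - s by ring, Complex.exp_sub,
      show (1 - ν) * (s : ℂ) = s - ν * s by ring, Complex.exp_sub]
    have e1 := Complex.exp_ne_zero (s : ℂ)
    have e2 := Complex.exp_ne_zero (ν * s : ℂ)
    field_simp
    ring
  have hW2 : Tendsto (fun s : ℝ => besselKInt ν s * (2 * Real.exp s * besselI (1 - ν) s) -
      -(2 * Real.exp s * besselKInt (ν - 1) s) * besselI (-ν) s) atBot (𝓝 2) := by
    have := (((tendsto_cexp_mul_atBot (a := 2 * (1 - ν)) (by simpa using h1)).mul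
        (hK.mul (hf (1 - ν)))).const_mul 2).add ((hK'.mul (hf (-ν))).const_mul 2)
    rw [neg_add_eq_sub, mul_inv_cancel₀ hΓ1, zero_mul, mul_zero, zero_add, mul_one] at this
    refine this.congr fun s => ?_
    rw [hsym, besselI, besselI, Complex.ofReal_exp,
      show 2 * (1 - ν) * (s : ℂ) = s + s - (ν * s + ν * s) by ring, Complex.exp_sub,
      Complex.exp_add, Complex.exp_add,
      show -ν * (s : ℂ) = -(ν * s) by ring, Complex.exp_neg,
      show (1 - ν) * (s : ℂ) = s - ν * s by ring, Complex.exp_sub]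
    have e1 := Complex.exp_ne_zero (s : ℂ)
    have e2 := Complex.exp_ne_zero (ν * s : ℂ)
    field_simp
    ring
  have hW3 : Tendsto (fun s : ℝ => besselI ν s * (2 * Real.exp s * besselI (1 - ν) s) -
      (2 * Real.exp s * besselI (ν - 1) s) * besselI (-ν) s) atBot
      (𝓝 (-(2 * (Complex.sin (Real.pi * ν) / Real.pi)))) := by
    have := (((tendsto_cexp_mul_atBot (a := 2) (by simp)).mul
        ((hf ν).mul (hf (1 - ν)))).const_mul 2).sub (((hf (ν - 1)).mul (hf (-ν))).const_mul 2)
    rw [sub_add_cancel, neg_add_eq_sub, zero_mul, mul_zero, zero_sub, ← mul_inv,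
      Complex.Gamma_mul_Gamma_one_sub, inv_div] at this
    refine this.congr fun s => ?_
    rw [besselI, besselI, besselI, besselI, Complex.ofReal_exp,
      show 2 * (s : ℂ) = s + s by ring, Complex.exp_add,
      show -ν * (s : ℂ) = -(ν * s) by ring, Complex.exp_neg,
      show (ν - 1) * (s : ℂ) = ν * s - s by ring, Complex.exp_sub,
      show (1 - ν) * (s : ℂ) = s - ν * s by ring, Complex.exp_sub]
    have e1 := Complex.exp_ne_zero (s : ℂ)
    have e2 := Complex.exp_ne_zero (ν * s : ℂ)
    field_simp
  have w1 := wronskian_eq (fun s => (hasDerivAt_system_besselKInt ν s).1)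
    (fun s => (hasDerivAt_system_besselKInt ν s).2)
    (fun s => (hasDerivAt_system_besselI ν s).1)
    (fun s => (hasDerivAt_system_besselI ν s).2) hW1 s
  have w2 := wronskian_eq (fun s => (hasDerivAt_system_besselKInt ν s).1)
    (fun s => (hasDerivAt_system_besselKInt ν s).2)
    (fun s => (hasDerivAt_system_besselI_neg ν s).1)
    (fun s => (hasDerivAt_system_besselI_neg ν s).2) hW2 s
  have w3 := wronskian_eq (fun s => (hasDerivAt_system_besselI ν s).1)
    (fun s => (hasDerivAt_system_besselI ν s).2)
    (fun s => (hasDerivAt_system_besselI_neg ν s).1)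
    (fun s => (hasDerivAt_system_besselI_neg ν s).2) hW3 s
  -- Three vectors in a plane satisfy $y_1W_{23}-y_2W_{13}+y_3W_{12}=0$.
  linear_combination (besselI (-ν) s * w1 - besselI ν s * w2 + besselKInt ν s * w3) / 2

/-- Both sides are entire in $\nu$ and agree near $\nu=1/2$. -/
lemma connection_formula (ν : ℂ) (s : ℝ) :
    Complex.sin (Real.pi * ν) / Real.pi * besselKInt ν s = besselI (-ν) s - besselI ν s := by
  have hl : Differentiable ℂ fun ν : ℂ => Complex.sin (Real.pi * ν) / Real.pi * besselKInt ν s :=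
    Differentiable.mul (by fun_prop) (differentiable_besselKInt_order s)
  have hr : Differentiable ℂ fun ν : ℂ => besselI (-ν) s - besselI ν s :=
    ((differentiable_besselI_order s).comp differentiable_neg).sub
      (differentiable_besselI_order s)
  have hev : (fun ν : ℂ => Complex.sin (Real.pi * ν) / Real.pi * besselKInt ν s) =ᶠ[𝓝 (1 / 2)]
      fun ν : ℂ => besselI (-ν) s - besselI ν s := by
    have hopen : IsOpen {ν : ℂ | 0 < ν.re ∧ ν.re < 1} :=
      (isOpen_lt continuous_const Complex.continuous_re).inter
        (isOpen_lt Complex.continuous_re continuous_const)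
    filter_upwards [hopen.mem_nhds (show (1 / 2 : ℂ) ∈ {ν : ℂ | 0 < ν.re ∧ ν.re < 1} by
      constructor <;> norm_num)] with ν hν
    exact connection_formula_of_mem_strip hν.1 hν.2 s
  exact congrFun (AnalyticOnNhd.eq_of_eventuallyEq (fun z _ => hl.analyticAt z)
    (fun z _ => hr.analyticAt z) hev) ν

/-! ### The Macdonald function on the horizontal strip `|Im s| ≤ π` -/

/-- `2 K_ν(2 e^s)` for noninteger `ν` and complex `s`. -/
def besselK (ν s : ℂ) : ℂ :=
  Real.pi / Complex.sin (Real.pi * ν) * (besselI (-ν) s - besselI ν s)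

lemma besselK_ofReal {ν : ℂ} (hν : Complex.sin (Real.pi * ν) ≠ 0) (s : ℝ) :
    besselK ν s = besselKInt ν s := by
  rw [besselK, ← connection_formula]
  have : (Real.pi : ℂ) ≠ 0 := by exact_mod_cast Real.pi_ne_zero
  field_simp

lemma sin_pi_mul_add_one (ν : ℂ) :
    Complex.sin (Real.pi * (ν + 1)) = -Complex.sin (Real.pi * ν) := by
  rw [mul_add, mul_one, Complex.sin_add_pi]

lemma sin_pi_mul_sub_one (ν : ℂ) :
    Complex.sin (Real.pi * (ν - 1)) = -Complex.sin (Real.pi * ν) := by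
  rw [mul_sub, mul_one, Complex.sin_sub_pi]

lemma hasDerivAt_besselK_succ (ν s : ℂ) :
    HasDerivAt (besselK ν) (ν * besselK ν s - 2 * Complex.exp s * besselK (ν + 1) s) s := by
  convert! ((hasDerivAt_besselI_pred (-ν) s).sub (hasDerivAt_besselI_succ ν s)).const_mul
    (Real.pi / Complex.sin (Real.pi * ν) : ℂ) using 1
  rw [besselK, besselK, sin_pi_mul_add_one, div_neg, neg_add', neg_neg]
  ring

lemma hasDerivAt_besselK_pred (ν s : ℂ) :
    HasDerivAt (besselK ν) (-ν * besselK ν s - 2 * Complex.exp s * besselK (ν - 1) s) s := by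
  convert! ((hasDerivAt_besselI_succ (-ν) s).sub (hasDerivAt_besselI_pred ν s)).const_mul
    (Real.pi / Complex.sin (Real.pi * ν) : ℂ) using 1
  rw [besselK, besselK, sin_pi_mul_sub_one, div_neg, neg_sub, sub_eq_add_neg 1 ν, add_comm 1 (-ν)]
  ring

/-- The derivative of `besselK ν`. -/
def besselKDeriv (ν s : ℂ) : ℂ := -(Complex.exp s * (besselK (ν + 1) s + besselK (ν - 1) s))

lemma hasDerivAt_besselK (ν s : ℂ) : HasDerivAt (besselK ν) (besselKDeriv ν s) s := by
  have h := (hasDerivAt_besselK_succ ν s).unique (hasDerivAt_besselK_pred ν s)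
  convert! hasDerivAt_besselK_succ ν s using 1
  rw [besselKDeriv]
  linear_combination -h / 2

lemma hasDerivAt_besselKDeriv (ν s : ℂ) :
    HasDerivAt (besselKDeriv ν) ((ν ^ 2 + 4 * Complex.exp s ^ 2) * besselK ν s) s := by
  have h := (hasDerivAt_besselK_succ ν s).unique (hasDerivAt_besselK_pred ν s)
  have h1 := hasDerivAt_besselK_pred (ν + 1) s
  have h2 := hasDerivAt_besselK_succ (ν - 1) s
  rw [add_sub_cancel_right] at h1
  rw [sub_add_cancel] at h2
  convert! ((Complex.hasDerivAt_exp s).mul (h1.add h2)).neg using 1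
  simp only [Pi.add_apply]
  linear_combination ν / 2 * h

/-! ### Energy estimate for the Macdonald function along vertical segments -/

/-- The Macdonald function with its exponential decay removed. -/
def besselKScaled (ν s : ℂ) : ℂ := Complex.exp (s / 2 + 2 * Complex.exp s) * besselK ν s

/-- The derivative of `besselKScaled`. -/
def besselKScaledDeriv (ν s : ℂ) : ℂ :=
  Complex.exp (s / 2 + 2 * Complex.exp s) *
    (besselKDeriv ν s + (1 / 2 + 2 * Complex.exp s) * besselK ν s)

lemma hasDerivAt_exp_phase (s : ℂ) :
    HasDerivAt (fun s : ℂ => Complex.exp (s / 2 + 2 * Complex.exp s))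
      (Complex.exp (s / 2 + 2 * Complex.exp s) * (1 / 2 + 2 * Complex.exp s)) s :=
  (((hasDerivAt_id s).div_const 2).add ((Complex.hasDerivAt_exp s).const_mul 2)).cexp

lemma hasDerivAt_besselKScaled (ν s : ℂ) :
    HasDerivAt (besselKScaled ν) (besselKScaledDeriv ν s) s := by
  convert! (hasDerivAt_exp_phase s).mul (hasDerivAt_besselK ν s) using 1
  rw [besselKScaledDeriv]
  ring

/-- The factor $e^{s/2}$ in the scaling is chosen so that every power of $e^s$ disappears from the
coefficient of the function itself; the unbounded $4e^s$ multiplies only the derivative. -/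
lemma hasDerivAt_besselKScaledDeriv (ν s : ℂ) :
    HasDerivAt (besselKScaledDeriv ν) ((4 * Complex.exp s + 1) * besselKScaledDeriv ν s +
      (ν ^ 2 - 1 / 4) * besselKScaled ν s) s := by
  convert! (hasDerivAt_exp_phase s).mul ((hasDerivAt_besselKDeriv ν s).add
    ((((Complex.hasDerivAt_exp s).const_mul 2).const_add (1 / 2)).mul
      (hasDerivAt_besselK ν s))) using 1
  simp only [Pi.add_apply, Pi.mul_apply]
  rw [besselKScaledDeriv, besselKScaled]
  ring

/-- The energy of the scaled Macdonald function. -/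
def besselEnergy (ν s : ℂ) : ℝ := ‖besselKScaled ν s‖ ^ 2 + ‖besselKScaledDeriv ν s‖ ^ 2

/-- Moving vertically away from the real line, `|Im s| ≤ π`, the energy grows at most by a
factor independent of `Re s`. -/
lemma besselEnergy_le (ν : ℂ) (σ : ℝ) {ε : ℝ} (hε : ε = 1 ∨ ε = -1) {θ : ℝ} (h0 : 0 ≤ θ)
    (hπ : θ ≤ Real.pi) :
    besselEnergy ν (σ + ε * θ * Complex.I) ≤
      Real.exp ((1 + ‖ν ^ 2 - 1 / 4‖) * θ) * besselEnergy ν σ := by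
  set κ : ℂ := ν ^ 2 - 1 / 4 with hκ
  set C : ℝ := 1 + ‖κ‖ with hC
  set path : ℝ → ℂ := fun x => σ + ε * x * Complex.I with hpath
  have hε2 : |ε| = 1 := by rcases hε with rfl | rfl <;> simp
  have hp : ∀ x, HasDerivAt path (ε * Complex.I) x := by
    intro x
    have : HasDerivAt (fun x : ℝ => (x : ℂ)) 1 x := (hasDerivAt_id x).ofReal_comp
    convert! ((this.const_mul (ε : ℂ)).mul_const Complex.I).const_add (σ : ℂ) using 1
    ring
  set g : ℝ → ℂ := fun x => besselKScaled ν (path x)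
  set p : ℝ → ℂ := fun x => besselKScaledDeriv ν (path x)
  have hg : ∀ x, HasDerivAt g (p x * (ε * Complex.I)) x := fun x =>
    (hasDerivAt_besselKScaled ν (path x)).comp x (hp x)
  have hpd : ∀ x, HasDerivAt p (((4 * Complex.exp (path x) + 1) * p x + κ * g x) *
      (ε * Complex.I)) x := fun x =>
    (hasDerivAt_besselKScaledDeriv ν (path x)).comp x (hp x)
  set E : ℝ → ℝ := fun x => ‖g x‖ ^ 2 + ‖p x‖ ^ 2 with hE
  set E' : ℝ → ℝ := fun x => 2 * inner ℝ (g x) (p x * (ε * Complex.I)) +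
    2 * inner ℝ (p x) (((4 * Complex.exp (path x) + 1) * p x + κ * g x) * (ε * Complex.I))
  have hEd : ∀ x, HasDerivAt E (E' x) x := fun x => (hg x).norm_sq.add (hpd x).norm_sq
  have hE'le : ∀ x ∈ Set.Icc 0 Real.pi, E' x ≤ C * E x := by
    intro x hx
    have hn : ‖(ε * Complex.I : ℂ)‖ = 1 := by simp [hε2]
    have i1 : inner ℝ (g x) (p x * (ε * Complex.I)) ≤ ‖g x‖ * ‖p x‖ := by
      refine (real_inner_le_norm _ _).trans_eq ?_
      rw [norm_mul, hn, mul_one]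
    have i2 : inner ℝ (p x) (κ * g x * (ε * Complex.I)) ≤ ‖κ‖ * (‖g x‖ * ‖p x‖) := by
      refine (real_inner_le_norm _ _).trans_eq ?_
      rw [norm_mul, hn, norm_mul]
      ring
    -- The decisive sign: the real part of $(4e^s+1)\,i\varepsilon$ is $-4e^\sigma\sin x$, which is
    -- nonpositive as long as $0\le x\le\pi$. Hence the growth rate does not depend on $\sigma$.
    have i3 : inner ℝ (p x) ((4 * Complex.exp (path x) + 1) * p x * (ε * Complex.I)) ≤ 0 := by
      have hre : inner ℝ (p x) ((4 * Complex.exp (path x) + 1) * p x * (ε * Complex.I)) =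
          -(4 * Real.exp σ * (ε * Real.sin (ε * x)) * ‖p x‖ ^ 2) := by
        rw [Complex.inner, ← Complex.normSq_eq_norm_sq]
        have : (4 * Complex.exp (path x) + 1) * p x * (ε * Complex.I) *
            (starRingEnd ℂ) (p x) = (4 * Complex.exp (path x) + 1) * (ε * Complex.I) *
              (Complex.normSq (p x) : ℂ) := by
          rw [← Complex.mul_conj]; ring
        have hexp : (Complex.exp (path x)).im = Real.exp σ * Real.sin (ε * x) := by
          rw [Complex.exp_im]; simp [hpath]
        have hre : ((4 * Complex.exp (path x) + 1) * (ε * Complex.I)).re =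
            -(4 * Real.exp σ * (ε * Real.sin (ε * x))) := by
          simp [hexp]
          ring
        rw [this, Complex.re_mul_ofReal, hre]
        ring
      rw [hre]
      have hsin : 0 ≤ ε * Real.sin (ε * x) := by
        have := Real.sin_nonneg_of_mem_Icc hx
        rcases hε with rfl | rfl <;> simpa using this
      have := Real.exp_pos σ
      have : 0 ≤ 4 * Real.exp σ * (ε * Real.sin (ε * x)) * ‖p x‖ ^ 2 := by positivity
      linarith
    have hsplit : E' x = 2 * inner ℝ (g x) (p x * (ε * Complex.I)) +
        2 * (inner ℝ (p x) ((4 * Complex.exp (path x) + 1) * p x * (ε * Complex.I)) +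
          inner ℝ (p x) (κ * g x * (ε * Complex.I))) := by
      rw [← inner_add_right, ← add_mul]
    have h2 : 2 * (‖g x‖ * ‖p x‖) ≤ E x := by
      have := sq_nonneg (‖g x‖ - ‖p x‖)
      simp only [hE]
      linarith
    have h3 := mul_le_mul_of_nonneg_left h2 (norm_nonneg κ)
    rw [hsplit, hC]
    linarith
  have hFd : ∀ x, HasDerivAt (fun x => Real.exp (-(C * x)) * E x)
      (Real.exp (-(C * x)) * (E' x - C * E x)) x := by
    intro x
    have h1 : HasDerivAt (fun x : ℝ => -(C * x)) (-C) x := by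
      convert! ((hasDerivAt_id x).const_mul C).neg using 1
      rw [mul_one]
    convert! h1.exp.mul (hEd x) using 1
    ring
  have hanti : AntitoneOn (fun x => Real.exp (-(C * x)) * E x) (Set.Icc 0 Real.pi) := by
    refine antitoneOn_of_deriv_nonpos (convex_Icc _ _)
      (fun x _ => (hFd x).continuousAt.continuousWithinAt)
      (fun x _ => (hFd x).differentiableAt.differentiableWithinAt) fun x hx => ?_
    rw [(hFd x).deriv]
    rw [interior_Icc] at hx
    exact mul_nonpos_of_nonneg_of_nonpos (Real.exp_pos _).le
      (sub_nonpos.2 (hE'le x ⟨hx.1.le, hx.2.le⟩))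
  have h := hanti (Set.left_mem_Icc.2 Real.pi_pos.le) ⟨h0, hπ⟩ h0
  have hE0 : E 0 = besselEnergy ν σ := by simp [hE, g, p, hpath, besselEnergy]
  have hEθ : E θ = besselEnergy ν (σ + ε * θ * Complex.I) := rfl
  simp only [mul_zero, neg_zero, Real.exp_zero, one_mul] at h
  rw [hE0, hEθ, Real.exp_neg, inv_mul_le_iff₀ (Real.exp_pos _)] at h
  exact h

lemma besselEnergy_ofReal_le {ν : ℂ} (hν : Complex.sin (Real.pi * ν) ≠ 0) (σ : ℝ) :
    besselEnergy ν σ ≤ 8 * Real.pi * Real.exp (‖ν‖ ^ 2 / Real.exp σ) := by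
  have hσ := Real.exp_pos σ
  set B : ℝ := √(2 * Real.pi) * Real.exp (ν.re ^ 2 / (2 * Real.exp σ)) with hB
  have hhalf : Real.exp (σ / 2) * √(2 * Real.pi / Real.exp σ) = √(2 * Real.pi) := by
    rw [Real.sqrt_div (by positivity), ← Real.exp_half]
    field_simp
  have hnorm : ∀ x : ℂ, ‖Complex.exp (σ / 2 + 2 * Complex.exp σ) * x‖ =
      Real.exp (σ / 2) * ‖Complex.exp (2 * Real.exp σ) * x‖ := by
    intro x
    rw [Complex.exp_add, mul_assoc, norm_mul, Complex.norm_exp (σ / 2), Complex.ofReal_exp]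
    simp
  have h1 : ‖besselKScaled ν σ‖ ≤ B := by
    rw [besselKScaled, hnorm, besselK_ofReal hν]
    refine (mul_le_mul_of_nonneg_left (norm_besselKInt_le ν σ) (Real.exp_pos _).le).trans_eq ?_
    rw [← mul_assoc, hhalf]
  -- The extra $1/2$ comes from differentiating $e^{s/2}$. Then $1+(3/2)^2\le4$ leads to the
  -- constant $8\pi=4\cdot2\pi$.
  have h2 : ‖besselKScaledDeriv ν σ‖ ≤ 3 / 2 * B := by
    have hsplit : besselKScaledDeriv ν σ = Complex.exp (σ / 2 + 2 * Complex.exp σ) *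
        (2 * Real.exp σ * besselKInt ν σ -
          Real.exp σ * (besselKInt (ν + 1) σ + besselKInt (ν - 1) σ)) +
        1 / 2 * besselKScaled ν σ := by
      rw [besselKScaledDeriv, besselKScaled, besselKDeriv, besselK_ofReal hν,
        besselK_ofReal (by rwa [sin_pi_mul_add_one, neg_ne_zero]),
        besselK_ofReal (by rwa [sin_pi_mul_sub_one, neg_ne_zero]), Complex.ofReal_exp]
      ring
    have h3 : ‖Complex.exp (σ / 2 + 2 * Complex.exp σ) *
        (2 * Real.exp σ * besselKInt ν σ -
          Real.exp σ * (besselKInt (ν + 1) σ + besselKInt (ν - 1) σ))‖ ≤ B := by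
      rw [hnorm]
      refine (mul_le_mul_of_nonneg_left (norm_besselKInt_deriv_le ν σ)
        (Real.exp_pos _).le).trans_eq ?_
      rw [← mul_assoc, hhalf]
    rw [hsplit]
    refine (norm_add_le _ _).trans ?_
    have h4 : ‖(1 / 2 : ℂ)‖ = 1 / 2 := by norm_num
    rw [norm_mul (1 / 2 : ℂ), h4]
    linarith
  have hB2 : B ^ 2 ≤ 2 * Real.pi * Real.exp (‖ν‖ ^ 2 / Real.exp σ) := by
    rw [hB, mul_pow, Real.sq_sqrt (by positivity), ← Real.exp_nat_mul]
    gcongr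
    have h4 : ν.re ^ 2 ≤ ‖ν‖ ^ 2 := by
      rw [← sq_abs ν.re]
      gcongr
      exact Complex.abs_re_le_norm ν
    calc _ = ν.re ^ 2 / Real.exp σ := by push_cast; field_simp
      _ ≤ _ := by gcongr
  have hB0 : 0 ≤ B := by positivity
  have h5 := pow_le_pow_left₀ (norm_nonneg _) h1 2
  have h6 := pow_le_pow_left₀ (norm_nonneg _) h2 2
  rw [besselEnergy]
  nlinarith

/-- The Macdonald function is `O(|w|^{-1/2} |e^{-w}|)`, `w = 2 e^s`, for `|arg w| ≤ π` and `|w|`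
bounded from below, locally uniformly in the order. -/
lemma exists_norm_besselKScaled_le (R σ₀ : ℝ) :
    ∃ C : ℝ, 0 ≤ C ∧ ∀ ν : ℂ, ‖ν‖ ≤ R → Complex.sin (Real.pi * ν) ≠ 0 → ∀ s : ℂ,
      σ₀ ≤ s.re → |s.im| ≤ Real.pi → ‖besselKScaled ν s‖ ≤ C := by
  refine ⟨√(Real.exp ((1 + (R ^ 2 + 1)) * Real.pi) *
    (8 * Real.pi * Real.exp (R ^ 2 / Real.exp σ₀))), Real.sqrt_nonneg _,
    fun ν hν hsin s hre him => Real.le_sqrt_of_sq_le ?_⟩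
  have hR : ‖ν‖ ^ 2 ≤ R ^ 2 := pow_le_pow_left₀ (norm_nonneg _) hν 2
  have h : besselEnergy ν s ≤
      Real.exp ((1 + ‖ν ^ 2 - 1 / 4‖) * |s.im|) * besselEnergy ν s.re := by
    rcases le_total 0 s.im with h0 | h0
    · have := besselEnergy_le ν s.re (ε := 1) (Or.inl rfl) h0 (by rwa [abs_of_nonneg h0] at him)
      rw [abs_of_nonneg h0]
      simpa using this
    · have := besselEnergy_le ν s.re (ε := -1) (Or.inr rfl) (neg_nonneg.2 h0)
        (by rwa [abs_of_nonpos h0] at him)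
      rw [abs_of_nonpos h0]
      simpa using this
  calc ‖besselKScaled ν s‖ ^ 2 ≤ besselEnergy ν s := by
        rw [besselEnergy]; exact le_add_of_nonneg_right (sq_nonneg _)
    _ ≤ _ := h
    _ ≤ _ := by
      gcongr
      · exact add_nonneg (sq_nonneg _) (sq_nonneg _)
      · calc ‖ν ^ 2 - 1 / 4‖ ≤ ‖ν ^ 2‖ + ‖(1 / 4 : ℂ)‖ := norm_sub_le _ _
          _ ≤ R ^ 2 + 1 := by rw [norm_pow]; norm_num; linarith
      · exact (besselEnergy_ofReal_le hsin s.re).trans (by gcongr)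

/-! ### The classical Bessel function in terms of the Macdonald function -/

lemma besselJ_eq_series (ν z : ℂ) :
    besselJ ν z = (z / 2) ^ ν * besselSeries ν (-(z / 2) ^ 2) := by
  rw [besselJ, besselSeries]
  congr 1
  refine tsum_congr fun k => ?_
  rw [neg_pow ((z / 2) ^ 2), ← pow_mul]

lemma besselJ_eq_exp (ν : ℂ) {z : ℂ} (hz : z ≠ 0) :
    besselJ ν z = Complex.exp (ν * Complex.log (z / 2)) * besselSeries ν (-(z / 2) ^ 2) := by
  rw [besselJ_eq_series, Complex.cpow_def_of_ne_zero (div_ne_zero hz two_ne_zero), mul_comm ν]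

lemma differentiable_besselJ_order {z : ℂ} (hz : z ≠ 0) :
    Differentiable ℂ fun ν => besselJ ν z := by
  simp_rw [besselJ_eq_exp _ hz]
  exact Differentiable.mul (by fun_prop) (differentiable_besselSeries_order _)

lemma measurable_besselJ (ν : ℂ) : Measurable (besselJ ν) := by
  have h : besselJ ν = fun z => (z / 2) ^ ν * besselSeries ν (-(z / 2) ^ 2) :=
    funext (besselJ_eq_series ν)
  rw [h]
  exact ((measurable_id.div_const 2).pow_const ν).mul
    ((continuous_besselSeries ν).comp (by fun_prop)).measurable

/-- `2 K_ν(-iz)`. -/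
def besselKLower (ν z : ℂ) : ℂ := besselK ν (Complex.log (z / 2) - Real.pi / 2 * Complex.I)

/-- `2 K_ν(iz)`. -/
def besselKUpper (ν z : ℂ) : ℂ := besselK ν (Complex.log (z / 2) + Real.pi / 2 * Complex.I)

/-- A shift of $s$ by $\mp i\pi/2$ gives $e^{2s}=-(z/2)^2$, which makes the series alternate. -/
lemma besselI_log_sub (ν : ℂ) {z : ℂ} (hz : z ≠ 0) :
    besselI ν (Complex.log (z / 2) - Real.pi / 2 * Complex.I) =
      Complex.exp (-(Real.pi * ν / 2 * Complex.I)) * besselJ ν z := by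
  rw [besselI, besselJ_eq_exp ν hz, ← mul_assoc, ← Complex.exp_add]
  congr 2
  · ring
  · rw [show (2 : ℂ) * (Complex.log (z / 2) - Real.pi / 2 * Complex.I) =
      2 * Complex.log (z / 2) - Real.pi * Complex.I by ring, Complex.exp_sub, Complex.exp_pi_mul_I,
      two_mul, Complex.exp_add, Complex.exp_log (div_ne_zero hz two_ne_zero)]
    ring

lemma besselI_log_add (ν : ℂ) {z : ℂ} (hz : z ≠ 0) :
    besselI ν (Complex.log (z / 2) + Real.pi / 2 * Complex.I) =
      Complex.exp (Real.pi * ν / 2 * Complex.I) * besselJ ν z := by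
  rw [besselI, besselJ_eq_exp ν hz, ← mul_assoc, ← Complex.exp_add]
  congr 2
  · ring
  · rw [show (2 : ℂ) * (Complex.log (z / 2) + Real.pi / 2 * Complex.I) =
      2 * Complex.log (z / 2) + Real.pi * Complex.I by ring, Complex.exp_add, Complex.exp_pi_mul_I,
      two_mul, Complex.exp_add, Complex.exp_log (div_ne_zero hz two_ne_zero)]
    ring

lemma sin_pi_mul_eq (ν : ℂ) : Complex.sin (Real.pi * ν) =
    (Complex.exp (-(Real.pi * ν / 2 * Complex.I)) ^ 2 -
      Complex.exp (Real.pi * ν / 2 * Complex.I) ^ 2) * Complex.I / 2 := by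
  rw [Complex.sin, ← Complex.exp_nat_mul, ← Complex.exp_nat_mul]
  push_cast
  ring_nf

/-- The two rotated Macdonald functions are linear in $J_{\pm\nu}$; the system is inverted, with
determinant proportional to $\sin\pi\nu$. Up to constants this is the expression of $J_{\pm\nu}$ by
Hankel functions. -/
lemma besselJ_eq_besselK {ν z : ℂ} (hν : Complex.sin (Real.pi * ν) ≠ 0) (hz : z ≠ 0) :
    2 * Real.pi * Complex.I * besselJ ν z =
        (Complex.exp (Real.pi * ν / 2 * Complex.I))⁻¹ * besselKLower ν z -
          Complex.exp (Real.pi * ν / 2 * Complex.I) * besselKUpper ν z ∧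
      2 * Real.pi * Complex.I * besselJ (-ν) z =
        Complex.exp (Real.pi * ν / 2 * Complex.I) * besselKLower ν z -
          (Complex.exp (Real.pi * ν / 2 * Complex.I))⁻¹ * besselKUpper ν z := by
  have hs := sin_pi_mul_eq ν
  rw [besselKLower, besselKUpper, besselK, besselK, besselI_log_sub _ hz, besselI_log_add _ hz,
    besselI_log_sub _ hz, besselI_log_add _ hz,
    show Real.pi * -ν / 2 * Complex.I = -(Real.pi * ν / 2 * Complex.I) by ring, neg_neg]
  rw [Complex.exp_neg] at hs ⊢
  have hu := Complex.exp_ne_zero (Real.pi * ν / 2 * Complex.I)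
  set u := Complex.exp (Real.pi * ν / 2 * Complex.I)
  set S := Complex.sin (Real.pi * ν)
  have hSI : 2 * Complex.I * S = u ^ 2 - u⁻¹ ^ 2 := by
    rw [hs]
    linear_combination (u⁻¹ ^ 2 - u ^ 2) * Complex.I_mul_I
  have huu : u * u⁻¹ = 1 := mul_inv_cancel₀ hu
  constructor
  · rw [← mul_right_inj' hν]
    have : S * (u⁻¹ * (Real.pi / S * (u * besselJ (-ν) z - u⁻¹ * besselJ ν z)) -
        u * (Real.pi / S * (u⁻¹ * besselJ (-ν) z - u * besselJ ν z))) =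
        Real.pi * (u ^ 2 - u⁻¹ ^ 2) * besselJ ν z := by
      field_simp
      ring
    rw [this, ← hSI]
    ring
  · rw [← mul_right_inj' hν]
    have : S * (u * (Real.pi / S * (u * besselJ (-ν) z - u⁻¹ * besselJ ν z)) -
        u⁻¹ * (Real.pi / S * (u⁻¹ * besselJ (-ν) z - u * besselJ ν z))) =
        Real.pi * (u ^ 2 - u⁻¹ ^ 2) * besselJ (-ν) z := by
      field_simp
      ring
    rw [this, ← hSI]
    ring

/-- `K_ν(∓iz)` is `O(|z|^{-1/2} e^{∓ Im z})` in the closed right half plane, away from `0`. -/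
lemma exists_norm_besselKLower_le (R : ℝ) {r : ℝ} (hr : 0 < r) :
    ∃ C : ℝ, 0 ≤ C ∧ ∀ ν : ℂ, ‖ν‖ ≤ R → Complex.sin (Real.pi * ν) ≠ 0 → ∀ z : ℂ,
      r ≤ ‖z‖ → 0 ≤ z.re →
        ‖besselKLower ν z‖ ≤ C * (√‖z‖)⁻¹ * Real.exp (-z.im) ∧
        ‖besselKUpper ν z‖ ≤ C * (√‖z‖)⁻¹ * Real.exp z.im := by
  obtain ⟨C, hC0, hC⟩ := exists_norm_besselKScaled_le R (Real.log (r / 2))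
  refine ⟨C * √2, by positivity, fun ν hν hsin z hz hre => ?_⟩
  have hz0 : 0 < ‖z‖ := hr.trans_le hz
  have hz2 : z / 2 ≠ 0 := div_ne_zero (norm_pos_iff.1 hz0) two_ne_zero
  set τ := Complex.log (z / 2) with hτ
  have hτre : τ.re = Real.log (‖z‖ / 2) := by rw [hτ, Complex.log_re]; simp
  have hτim : |τ.im| ≤ Real.pi / 2 := by
    rw [hτ, Complex.log_im, Complex.abs_arg_le_pi_div_two_iff]
    simpa using div_nonneg hre zero_le_two
  have hle : Real.log (r / 2) ≤ τ.re := by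
    rw [hτre]
    exact Real.log_le_log (by positivity) (by linarith)
  have hexpτ : Complex.exp τ = z / 2 := Complex.exp_log hz2
  have hhalf : Complex.exp (Real.pi / 2 * Complex.I) = Complex.I := Complex.exp_pi_div_two_mul_I
  have hsqrt : Real.exp (τ.re / 2) = √‖z‖ / √2 := by
    rw [Real.exp_half, hτre, Real.exp_log (by positivity), Real.sqrt_div hz0.le]
  -- At $s=\tau\mp i\pi/2$ one has $2e^s=\mp iz$, with real part $\pm\operatorname{Im}z$; this is
  -- $a$ below. As $|\operatorname{Im}\tau|\le\pi/2$, the shifted points just fit into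
  -- $|\operatorname{Im}s|\le\pi$.
  have hfinal : ∀ {a b : ℝ} {K : ℂ}, Real.exp (τ.re / 2 + a) * ‖K‖ ≤ C → b = -a →
      ‖K‖ ≤ C * √2 * (√‖z‖)⁻¹ * Real.exp b := by
    intro a b K h hb
    have h1 : 0 < √‖z‖ := Real.sqrt_pos.2 hz0
    have h2 := Real.exp_pos a
    rw [Real.exp_add, hsqrt] at h
    rw [hb, Real.exp_neg]
    calc ‖K‖ = (√‖z‖ / √2 * Real.exp a * ‖K‖) * (√2 * (√‖z‖)⁻¹ * (Real.exp a)⁻¹) := by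
          field_simp
      _ ≤ C * (√2 * (√‖z‖)⁻¹ * (Real.exp a)⁻¹) := by gcongr
      _ = _ := by ring
  have habs := abs_le.1 hτim
  constructor
  · have h := hC ν hν hsin (τ - Real.pi / 2 * Complex.I) (by simpa using hle) (by
      rw [abs_le]; constructor <;> simp <;> linarith)
    rw [besselKScaled, norm_mul, Complex.norm_exp, Complex.exp_sub, hhalf, hexpτ] at h
    refine hfinal (a := z.im) ?_ rfl
    rw [besselKLower, ← hτ]
    convert h using 3
    simp
    ring
  · have h := hC ν hν hsin (τ + Real.pi / 2 * Complex.I) (by simpa using hle) (by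
      rw [abs_le]; constructor <;> simp <;> linarith)
    rw [besselKScaled, norm_mul, Complex.norm_exp, Complex.exp_add, hhalf, hexpτ] at h
    refine hfinal (a := -z.im) ?_ (neg_neg _).symm
    rw [besselKUpper, ← hτ]
    convert h using 3
    simp
    ring

/-! ### The bold Bessel function -/

/-- The order `μ` is generic for `𝑱_{μ,m}`. -/
def IsGeneric (μ : ℂ) (m : ℤ) : Prop := ¬ ∃ k : ℤ, 4 * μ = 2 * k + m

/-- Genericity says that $2\mu+m/2$ and $2\mu-m/2$, which differ by the integer $m$, are not
integers, so both Macdonald functions are given by the quotient formula. -/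
lemma IsGeneric.sin_add_ne_zero {μ : ℂ} {m : ℤ} (h : IsGeneric μ m) :
    Complex.sin (Real.pi * (2 * μ + m / 2)) ≠ 0 := by
  intro h0
  obtain ⟨k, hk⟩ := Complex.sin_eq_zero_iff.1 h0
  have hπ : (Real.pi : ℂ) ≠ 0 := by exact_mod_cast Real.pi_ne_zero
  have : 2 * μ + m / 2 = k := mul_left_cancel₀ hπ (by rw [hk]; ring)
  exact h ⟨k - m, by push_cast; linear_combination 2 * this⟩

lemma IsGeneric.sin_sub_ne_zero {μ : ℂ} {m : ℤ} (h : IsGeneric μ m) :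
    Complex.sin (Real.pi * (2 * μ - m / 2)) ≠ 0 := by
  intro h0
  obtain ⟨k, hk⟩ := Complex.sin_eq_zero_iff.1 h0
  have hπ : (Real.pi : ℂ) ≠ 0 := by exact_mod_cast Real.pi_ne_zero
  have : 2 * μ - m / 2 = k := mul_left_cancel₀ hπ (by rw [hk]; ring)
  exact h ⟨k, by linear_combination 2 * this⟩

lemma IsGeneric.sin_ne_zero {μ : ℂ} {m : ℤ} (h : IsGeneric μ m) (hm : Even m) :
    Complex.sin (2 * Real.pi * μ) ≠ 0 := by
  intro h0
  obtain ⟨k, hk⟩ := Complex.sin_eq_zero_iff.1 h0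
  obtain ⟨j, rfl⟩ := hm
  have hπ : (Real.pi : ℂ) ≠ 0 := by exact_mod_cast Real.pi_ne_zero
  have : 2 * μ = k := mul_left_cancel₀ hπ (by linear_combination hk)
  exact h ⟨k - j, by push_cast; linear_combination 2 * this⟩

lemma IsGeneric.cos_ne_zero {μ : ℂ} {m : ℤ} (h : IsGeneric μ m) (hm : ¬ Even m) :
    Complex.cos (2 * Real.pi * μ) ≠ 0 := by
  intro h0
  obtain ⟨k, hk⟩ := Complex.cos_eq_zero_iff.1 h0
  obtain ⟨j, rfl⟩ := Int.not_even_iff_odd.1 hm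
  have hπ : (Real.pi : ℂ) ≠ 0 := by exact_mod_cast Real.pi_ne_zero
  have : 4 * μ = 2 * k + 1 := mul_left_cancel₀ hπ (by linear_combination 2 * hk)
  exact h ⟨k - j, by push_cast; linear_combination this⟩

lemma eventually_isGeneric (μ : ℂ) (m : ℤ) : ∀ᶠ μ' in 𝓝[≠] μ, IsGeneric μ' m := by
  by_cases h : IsGeneric μ m
  · have hcont : ContinuousAt (fun μ : ℂ => Complex.sin (Real.pi * (2 * μ - m / 2))) μ := by
      fun_prop
    filter_upwards [nhdsWithin_le_nhds (hcont.eventually_ne h.sin_sub_ne_zero)] with μ' hμ'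
    rintro ⟨k, hk⟩
    refine hμ' (Complex.sin_eq_zero_iff.2 ⟨k, ?_⟩)
    linear_combination Real.pi / 2 * hk
  · obtain ⟨k, hk⟩ := not_not.1 h
    filter_upwards [self_mem_nhdsWithin,
      nhdsWithin_le_nhds (Metric.ball_mem_nhds μ (show (0 : ℝ) < 1 / 4 by norm_num))]
      with μ' hne hball
    rintro ⟨k', hk'⟩
    rw [mem_ball_iff_norm] at hball
    have hsub : 2 * (μ' - μ) = ((k' - k : ℤ) : ℂ) := by push_cast; linear_combination (hk' - hk) / 2
    have hn : ‖((k' - k : ℤ) : ℂ)‖ < 1 := by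
      rw [← hsub, norm_mul, Complex.norm_ofNat]
      linarith
    rw [Complex.norm_intCast, ← Int.cast_abs] at hn
    have hkk : k' - k = 0 := Int.abs_lt_one_iff.1 (by exact_mod_cast hn)
    rw [hkk, Int.cast_zero] at hsub
    exact hne (sub_eq_zero.1 ((mul_eq_zero.1 hsub).resolve_left two_ne_zero))

lemma besselJJ_eq (μ : ℂ) (m : ℤ) (z : ℂ) :
    besselJJ μ m z = besselJ (-(2 * μ + m / 2)) z *
      besselJ (-(2 * μ - m / 2)) (starRingEnd ℂ z) := by
  rw [besselJJ]
  ring_nf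

lemma besselJJ_neg_eq (μ : ℂ) (m : ℤ) (z : ℂ) :
    besselJJ (-μ) (-m) z = besselJ (2 * μ + m / 2) z *
      besselJ (2 * μ - m / 2) (starRingEnd ℂ z) := by
  rw [besselJJ]
  push_cast
  ring_nf

/-- The bold Bessel function as a combination of products of Hankel functions, in which the
exponentially growing products cancel. -/
lemma boldJGeneric_eq {μ : ℂ} {m : ℤ} (h : IsGeneric μ m) {z w : ℂ}
    (hw : w = 4 * Real.pi * z ^ (1 / 2 : ℂ)) (hw0 : w ≠ 0) :
    boldJGeneric μ m z = -Complex.I *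
      (besselKLower (2 * μ + m / 2) w * besselKLower (2 * μ - m / 2) (starRingEnd ℂ w) -
        (if Even m then 1 else -1) *
        (besselKUpper (2 * μ + m / 2) w * besselKUpper (2 * μ - m / 2) (starRingEnd ℂ w))) := by
  have hw0' : starRingEnd ℂ w ≠ 0 := by simpa using hw0
  obtain ⟨e1, e2⟩ := besselJ_eq_besselK h.sin_add_ne_zero hw0
  obtain ⟨e3, e4⟩ := besselJ_eq_besselK h.sin_sub_ne_zero hw0'
  set k₁ := besselKLower (2 * μ + m / 2) w
  set k₂ := besselKUpper (2 * μ + m / 2) w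
  set k₁' := besselKLower (2 * μ - m / 2) (starRingEnd ℂ w)
  set k₂' := besselKUpper (2 * μ - m / 2) (starRingEnd ℂ w)
  have ha := Complex.exp_ne_zero (Real.pi * (2 * μ + m / 2) / 2 * Complex.I)
  have hb := Complex.exp_ne_zero (Real.pi * (2 * μ - m / 2) / 2 * Complex.I)
  have hab : Complex.exp (Real.pi * (2 * μ + m / 2) / 2 * Complex.I) *
      Complex.exp (Real.pi * (2 * μ - m / 2) / 2 * Complex.I) =
      Complex.exp (2 * Real.pi * μ * Complex.I) := by
    rw [← Complex.exp_add]; congr 1; ring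
  -- This is $a^2=(-1)^mb^2$. With the sign chosen according to the parity of $m$ in the definition
  -- of $\boldsymbol J$, it makes the mixed products $k_1k_2'$ and $k_2k_1'$ cancel.
  have hdiv : Complex.exp (Real.pi * (2 * μ + m / 2) / 2 * Complex.I) ^ 2 =
      Complex.exp (Real.pi * (2 * μ - m / 2) / 2 * Complex.I) ^ 2 *
        Complex.exp (Real.pi * Complex.I) ^ m := by
    rw [← Complex.exp_nat_mul, ← Complex.exp_nat_mul, ← Complex.exp_int_mul, ← Complex.exp_add]
    congr 1
    push_cast
    ring
  rw [Complex.exp_pi_mul_I] at hdiv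
  have hsin : Complex.sin (2 * Real.pi * μ) =
      ((Complex.exp (2 * Real.pi * μ * Complex.I))⁻¹ -
        Complex.exp (2 * Real.pi * μ * Complex.I)) * Complex.I / 2 := by
    rw [Complex.sin, ← Complex.exp_neg]
    ring_nf
  have hcos : Complex.cos (2 * Real.pi * μ) =
      (Complex.exp (2 * Real.pi * μ * Complex.I) +
        (Complex.exp (2 * Real.pi * μ * Complex.I))⁻¹) / 2 := by
    rw [Complex.cos, ← Complex.exp_neg]
    ring_nf
  rw [← hab] at hsin hcos
  set a := Complex.exp (Real.pi * (2 * μ + m / 2) / 2 * Complex.I)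
  set b := Complex.exp (Real.pi * (2 * μ - m / 2) / 2 * Complex.I)
  have hπ : (Real.pi : ℂ) ≠ 0 := by exact_mod_cast Real.pi_ne_zero
  have hI := Complex.I_mul_I
  have p1 : -4 * Real.pi ^ 2 * besselJJ μ m w =
      (a * k₁ - a⁻¹ * k₂) * (b * k₁' - b⁻¹ * k₂') := by
    rw [← e2, ← e4, besselJJ_eq]
    linear_combination (-4 * Real.pi ^ 2 * (besselJ (-(2 * μ + m / 2)) w *
      besselJ (-(2 * μ - m / 2)) (starRingEnd ℂ w))) * hI
  have p2 : -4 * Real.pi ^ 2 * besselJJ (-μ) (-m) w =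
      (a⁻¹ * k₁ - a * k₂) * (b⁻¹ * k₁' - b * k₂') := by
    rw [← e1, ← e3, besselJJ_neg_eq]
    linear_combination (-4 * Real.pi ^ 2 * (besselJ (2 * μ + m / 2) w *
      besselJ (2 * μ - m / 2) (starRingEnd ℂ w))) * hI
  rw [boldJGeneric]
  simp only [← hw]
  by_cases hm : Even m
  · rw [if_pos hm, if_pos hm]
    have hs := h.sin_ne_zero hm
    rw [hm.neg_one_zpow, mul_one] at hdiv
    have hcross : a * b⁻¹ = a⁻¹ * b := by
      field_simp
      exact hdiv
    have key : -4 * Real.pi ^ 2 * (besselJJ μ m w - besselJJ (-μ) (-m) w) =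
        2 * Complex.I * Complex.sin (2 * Real.pi * μ) * (k₁ * k₁' - k₂ * k₂') := by
      rw [mul_sub, p1, p2, hsin, mul_inv]
      linear_combination (k₂ * k₁' - k₁ * k₂') * hcross -
        (a⁻¹ * b⁻¹ - a * b) * (k₁ * k₁' - k₂ * k₂') * hI
    have hres : besselJJ μ m w - besselJJ (-μ) (-m) w =
        2 * Complex.I * Complex.sin (2 * Real.pi * μ) * (k₁ * k₁' - k₂ * k₂') /
          (-4 * Real.pi ^ 2) := by
      rw [← key]
      field_simp
    rw [hres]
    field_simp
    ring
  · rw [if_neg hm, if_neg hm]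
    have hs := h.cos_ne_zero hm
    rw [(Int.not_even_iff_odd.1 hm).neg_one_zpow] at hdiv
    have hcross : a * b⁻¹ = -(a⁻¹ * b) := by
      field_simp
      linear_combination hdiv
    have key : -4 * Real.pi ^ 2 * (besselJJ μ m w + besselJJ (-μ) (-m) w) =
        2 * Complex.cos (2 * Real.pi * μ) * (k₁ * k₁' + k₂ * k₂') := by
      rw [mul_add, p1, p2, hcos, mul_inv]
      linear_combination (-k₂ * k₁' - k₁ * k₂') * hcross
    have hres : besselJJ μ m w + besselJJ (-μ) (-m) w =
        2 * Complex.cos (2 * Real.pi * μ) * (k₁ * k₁' + k₂ * k₂') / (-4 * Real.pi ^ 2) := by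
      rw [← key]
      field_simp
    rw [hres]
    field_simp
    ring

/-! ### Bounds for the bold Bessel function -/

lemma norm_four_pi_sqrt (z : ℂ) :
    ‖4 * Real.pi * z ^ (1 / 2 : ℂ)‖ = 4 * Real.pi * √‖z‖ := by
  have h : ‖z ^ (1 / 2 : ℂ)‖ = √‖z‖ := by
    rw [Real.sqrt_eq_rpow, show (1 / 2 : ℂ) = ((1 / 2 : ℝ) : ℂ) by push_cast; rfl,
      Complex.norm_cpow_real]
  rw [norm_mul, norm_mul, h, Complex.norm_real, Complex.norm_ofNat,
    Real.norm_of_nonneg Real.pi_pos.le]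

lemma re_four_pi_sqrt_nonneg {z : ℂ} (hz : z ≠ 0) :
    0 ≤ (4 * Real.pi * z ^ (1 / 2 : ℂ)).re := by
  have h : 0 ≤ (z ^ (1 / 2 : ℂ)).re := by
    rw [Complex.cpow_def_of_ne_zero hz, Complex.exp_re]
    refine mul_nonneg (Real.exp_pos _).le (Real.cos_nonneg_of_mem_Icc ?_)
    have h1 := Complex.neg_pi_lt_arg z
    have h2 := Complex.arg_le_pi z
    have : (Complex.log z * (1 / 2)).im = z.arg / 2 := by
      simp [Complex.log_im]; ring
    rw [this]
    constructor <;> linarith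
  have h2 : (4 * Real.pi * z ^ (1 / 2 : ℂ)).re = 4 * Real.pi * (z ^ (1 / 2 : ℂ)).re := by
    rw [show (4 * Real.pi : ℂ) = ((4 * Real.pi : ℝ) : ℂ) by push_cast; rfl, Complex.re_ofReal_mul]
  rw [h2]
  have := Real.pi_pos
  positivity

/-- `𝑱_{μ,m}(z) = O(|z|^{-1/2})` away from `0`, locally uniformly in generic orders `μ`. -/
lemma exists_norm_boldJGeneric_le (m : ℤ) (R : ℝ) {r : ℝ} (hr : 0 < r) :
    ∃ C : ℝ, ∀ μ : ℂ, ‖μ‖ ≤ R → IsGeneric μ m → ∀ z : ℂ, r ≤ ‖z‖ →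
      √‖z‖ * ‖boldJGeneric μ m z‖ ≤ C := by
  have hπ := Real.pi_pos
  obtain ⟨C, hC0, hC⟩ := exists_norm_besselKLower_le (2 * R + ‖(m / 2 : ℂ)‖)
    (r := 4 * Real.pi * √r) (by positivity)
  refine ⟨2 * C ^ 2, fun μ hμ hgen z hz => ?_⟩
  have hz0 : 0 < ‖z‖ := hr.trans_le hz
  have hz' : z ≠ 0 := norm_pos_iff.1 hz0
  set w : ℂ := 4 * Real.pi * z ^ (1 / 2 : ℂ) with hw
  have hwn : ‖w‖ = 4 * Real.pi * √‖z‖ := norm_four_pi_sqrt z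
  have hs : 0 < √‖z‖ := Real.sqrt_pos.2 hz0
  have hw0 : w ≠ 0 := norm_pos_iff.1 (by rw [hwn]; positivity)
  have hrw : 4 * Real.pi * √r ≤ ‖w‖ := by
    rw [hwn]
    gcongr
  have hre : 0 ≤ w.re := re_four_pi_sqrt_nonneg hz'
  have h2μ : ‖2 * μ‖ ≤ 2 * R := by rw [norm_mul, Complex.norm_ofNat]; linarith
  obtain ⟨b1, b2⟩ := hC (2 * μ + m / 2) ((norm_add_le _ _).trans (by linarith))
    hgen.sin_add_ne_zero w hrw hre
  obtain ⟨b3, b4⟩ := hC (2 * μ - m / 2) ((norm_sub_le _ _).trans (by linarith))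
    hgen.sin_sub_ne_zero (starRingEnd ℂ w) (by rwa [RCLike.norm_conj]) (by simpa using hre)
  rw [RCLike.norm_conj, Complex.conj_im, neg_neg] at b3
  rw [RCLike.norm_conj, Complex.conj_im] at b4
  have hsw : (√‖w‖)⁻¹ * (√‖w‖)⁻¹ = ‖w‖⁻¹ := by
    rw [← mul_inv, Real.mul_self_sqrt (norm_nonneg w)]
  -- Conjugation reverses the imaginary part, so in each product the two exponentials are inverse to
  -- each other.
  have hee : Real.exp (-w.im) * Real.exp w.im = 1 := by rw [← Real.exp_add]; simp
  have hL := mul_le_mul b1 b3 (norm_nonneg _) (by positivity)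
  have hU := mul_le_mul b2 b4 (norm_nonneg _) (by positivity)
  have e1 : C * (√‖w‖)⁻¹ * Real.exp (-w.im) * (C * (√‖w‖)⁻¹ * Real.exp w.im) =
      C ^ 2 * ‖w‖⁻¹ := by
    linear_combination C ^ 2 * (Real.exp (-w.im) * Real.exp w.im) * hsw + C ^ 2 * ‖w‖⁻¹ * hee
  have e2 : C * (√‖w‖)⁻¹ * Real.exp w.im * (C * (√‖w‖)⁻¹ * Real.exp (-w.im)) =
      C ^ 2 * ‖w‖⁻¹ := by rw [← e1]; ring
  rw [e1, ← norm_mul] at hL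
  rw [e2, ← norm_mul] at hU
  have hsign : ‖(if Even m then 1 else -1 : ℂ)‖ = 1 := by split_ifs <;> simp
  have hJ : ‖boldJGeneric μ m z‖ ≤ 2 * C ^ 2 * ‖w‖⁻¹ := by
    rw [boldJGeneric_eq hgen hw hw0, norm_mul, norm_neg, Complex.norm_I, one_mul]
    refine (norm_sub_le _ _).trans ?_
    rw [norm_mul (if Even m then 1 else -1 : ℂ), hsign, one_mul]
    linarith
  calc √‖z‖ * ‖boldJGeneric μ m z‖ ≤ √‖z‖ * (2 * C ^ 2 * ‖w‖⁻¹) := by gcongr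
    _ = 2 * C ^ 2 * (4 * Real.pi)⁻¹ := by rw [hwn]; field_simp
    _ ≤ 2 * C ^ 2 * 1 := by
      gcongr
      exact inv_le_one_of_one_le₀ (by linarith [Real.pi_gt_three])
    _ = _ := mul_one _

lemma differentiableAt_boldJGeneric {μ : ℂ} {m : ℤ} (h : IsGeneric μ m) {z : ℂ} (hz : z ≠ 0) :
    DifferentiableAt ℂ (fun μ => boldJGeneric μ m z) μ := by
  have hw0 : 4 * Real.pi * z ^ (1 / 2 : ℂ) ≠ 0 := by
    rw [← norm_pos_iff, norm_four_pi_sqrt]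
    have := Real.pi_pos
    have := Real.sqrt_pos.2 (norm_pos_iff.2 hz)
    positivity
  have hw0' : starRingEnd ℂ (4 * Real.pi * z ^ (1 / 2 : ℂ)) ≠ 0 :=
    (map_ne_zero _).2 hw0
  have hJJ : ∀ (m : ℤ), Differentiable ℂ fun μ =>
      besselJJ μ m (4 * Real.pi * z ^ (1 / 2 : ℂ)) := by
    intro m
    exact ((differentiable_besselJ_order hw0).comp (by fun_prop)).mul
      ((differentiable_besselJ_order hw0').comp (by fun_prop))
  have hJJ1 := (hJJ m).differentiableAt (x := μ)
  have hJJ2 := ((hJJ (-m)).comp differentiable_neg).differentiableAt (x := μ)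
  simp only [boldJGeneric]
  split_ifs with hm
  · have hs := h.sin_ne_zero hm
    have hc : DifferentiableAt ℂ (fun μ : ℂ => 2 * Real.pi ^ 2 / Complex.sin (2 * Real.pi * μ)) μ :=
      (differentiableAt_const _).div (by fun_prop) hs
    exact hc.mul (hJJ1.sub hJJ2)
  · have hs := h.cos_ne_zero hm
    have hc : DifferentiableAt ℂ
        (fun μ : ℂ => 2 * Real.pi ^ 2 * Complex.I / Complex.cos (2 * Real.pi * μ)) μ :=
      (differentiableAt_const _).div (by fun_prop) hs
    exact hc.mul (hJJ1.add hJJ2)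

lemma boldJ_of_isGeneric {μ : ℂ} {m : ℤ} (h : IsGeneric μ m) (z : ℂ) :
    boldJ μ m z = boldJGeneric μ m z := if_neg h

/-- In the nongeneric case the limit defining the bold Bessel function exists; in fact the bold
Bessel function is continuous in the order. -/
lemma tendsto_boldJGeneric (μ : ℂ) (m : ℤ) {z : ℂ} (hz : z ≠ 0) :
    Tendsto (fun μ' => boldJGeneric μ' m z) (𝓝[≠] μ) (𝓝 (boldJ μ m z)) := by
  by_cases h : IsGeneric μ m
  · rw [boldJ_of_isGeneric h]
    exact (differentiableAt_boldJGeneric h hz).continuousAt.tendsto.mono_left nhdsWithin_le_nhds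
  · rw [boldJ, if_pos (not_not.1 h)]
    have hz0 : 0 < ‖z‖ := norm_pos_iff.2 hz
    have hev := eventually_isGeneric μ m
    refine Complex.tendsto_limUnder_of_differentiable_on_punctured_nhds_of_bounded_under
      (hev.mono fun μ' hμ' => differentiableAt_boldJGeneric hμ' hz) ?_
    obtain ⟨C, hC⟩ := exists_norm_boldJGeneric_le m (‖μ‖ + 1) hz0
    -- The removable singularity criterion bounds the difference from the value assigned at $\mu$
    -- itself, hence the second summand.
    refine isBoundedUnder_of_eventually_le (a := C / √‖z‖ + ‖boldJGeneric μ m z‖) ?_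
    filter_upwards [hev, nhdsWithin_le_nhds (Metric.ball_mem_nhds μ one_pos)] with μ' hμ' hball
    refine (norm_sub_le _ _).trans (add_le_add_left ?_ _)
    have hn : ‖μ'‖ ≤ ‖μ‖ + 1 := by
      have h1 := norm_le_norm_add_norm_sub' μ' μ
      have h2 := (mem_ball_iff_norm.1 hball).le
      linarith
    rw [le_div_iff₀' (Real.sqrt_pos.2 hz0)]
    exact hC μ' hn hμ' z le_rfl

/-- The bound over generic orders near $\mu$ is uniform, so it passes to the limit $\mu'\to\mu$. -/
lemma exists_norm_boldJ_le (μ : ℂ) (m : ℤ) {r : ℝ} (hr : 0 < r) :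
    ∃ C : ℝ, ∀ z : ℂ, r ≤ ‖z‖ → √‖z‖ * ‖boldJ μ m z‖ ≤ C := by
  obtain ⟨C, hC⟩ := exists_norm_boldJGeneric_le m (‖μ‖ + 1) hr
  refine ⟨C, fun z hz => ?_⟩
  have ht := tendsto_boldJGeneric μ m (norm_pos_iff.1 (hr.trans_le hz))
  refine le_of_tendsto (ht.norm.const_mul (√‖z‖)) ?_
  filter_upwards [eventually_isGeneric μ m,
    nhdsWithin_le_nhds (Metric.ball_mem_nhds μ one_pos)] with μ' hμ' hball
  have hn : ‖μ'‖ ≤ ‖μ‖ + 1 := by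
    have h1 := norm_le_norm_add_norm_sub' μ' μ
    have h2 := (mem_ball_iff_norm.1 hball).le
    linarith
  exact hC μ' hn hμ' z hz

/-! ### Measurability -/

lemma measurable_boldJGeneric (μ : ℂ) (m : ℤ) : Measurable (boldJGeneric μ m) := by
  have hw : Measurable fun z : ℂ => 4 * Real.pi * z ^ (1 / 2 : ℂ) :=
    (measurable_id.pow_const _).const_mul _
  have hJJ : ∀ (μ : ℂ) (m : ℤ), Measurable (besselJJ μ m) := fun μ m =>
    (measurable_besselJ _).mul ((measurable_besselJ _).comp Complex.continuous_conj.measurable)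
  unfold boldJGeneric
  split_ifs
  · exact (((hJJ _ _).comp hw).sub ((hJJ _ _).comp hw)).const_mul _
  · exact (((hJJ _ _).comp hw).add ((hJJ _ _).comp hw)).const_mul _

/-- Away from $z=0$ the limit in the order may be taken along the sequence $\mu+1/(n+1)$, and a
pointwise limit of a sequence of measurable functions is measurable. At $z=0$ convergence is not
known, so the value is reset. -/
lemma exists_measurable_eq_boldJ (μ : ℂ) (m : ℤ) :
    ∃ F : ℂ → ℂ, Measurable F ∧ ∀ z ≠ 0, F z = boldJ μ m z := by
  classical
  refine ⟨fun z => if z = 0 then 0 else boldJ μ m z, ?_, fun z hz => if_neg hz⟩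
  have hseq : Tendsto (fun n : ℕ => μ + 1 / ((n : ℂ) + 1)) atTop (𝓝[≠] μ) := by
    refine tendsto_nhdsWithin_iff.2 ⟨?_, Eventually.of_forall fun n => ?_⟩
    · simpa using (tendsto_one_div_add_atTop_nhds_zero_nat (𝕜 := ℂ)).const_add μ
    · have : (n : ℂ) + 1 ≠ 0 := by exact_mod_cast n.succ_ne_zero
      simpa using this
  refine measurable_of_tendsto_metrizable
    (f := fun (n : ℕ) (z : ℂ) => if z = 0 then 0 else boldJGeneric (μ + 1 / ((n : ℂ) + 1)) m z)
    (fun n => Measurable.ite (measurableSet_singleton 0) measurable_const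
      (measurable_boldJGeneric _ m)) (tendsto_pi_nhds.2 fun z => ?_)
  by_cases hz : z = 0
  · simp [hz]
  · simp only [if_neg hz]
    exact (tendsto_boldJGeneric μ m hz).comp hseq

/-! ### Local integrability of the relative Bessel function -/

instance : LocallyCompactSpace (Matrix (Fin 2) (Fin 2) ℂ) :=
  inferInstanceAs (LocallyCompactSpace (Fin 2 → Fin 2 → ℂ))

lemma continuous_entry (i j : Fin 2) : Continuous fun g : G => g.1 i j :=
  Units.continuous_val.matrix_elem i j

lemma continuous_det : Continuous fun g : G => g.1.det :=
  Continuous.matrix_det Units.continuous_val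

lemma det_ne_zero (g : G) : g.1.det ≠ 0 := ((Matrix.isUnit_iff_isUnit_det _).1 g.isUnit).ne_zero

/-- The coordinates are read off from `decomp_val`: $c=g_{21}$, $y=g_{22}/g_{21}$, while $\det
g=-ac^2$ gives $a$ and then $x$. -/
lemma mem_U_iff (g : G) : g ∈ U ↔ g.1 0 0 * g.1 1 0 ≠ 0 := by
  constructor
  · rintro ⟨a, c, x, y, hx, rfl⟩
    rw [decomp_val]
    simpa using hx
  · intro h
    have h0 := left_ne_zero_of_mul h
    have h1 := right_ne_zero_of_mul h
    have hd := det_ne_zero g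
    refine ⟨Units.mk0 (-g.1.det / g.1 1 0 ^ 2)
      (div_ne_zero (neg_ne_zero.2 hd) (pow_ne_zero _ h1)), Units.mk0 (g.1 1 0) h1,
      -(g.1 0 0 * g.1 1 0) / g.1.det, g.1 1 1 / g.1 1 0,
      div_ne_zero (neg_ne_zero.2 h) hd, Units.ext ?_⟩
    rw [decomp_val]
    have hdet : g.1.det = g.1 0 0 * g.1 1 1 - g.1 0 1 * g.1 1 0 := Matrix.det_fin_two _
    ext i j
    fin_cases i <;> fin_cases j <;> simp only [Units.val_mk0] <;> simp
    · field_simp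
    · field_simp
      linear_combination hdet
    · field_simp

lemma norm_psi (lam z : ℂ) : ‖psi lam z‖ = 1 := by
  have h : 2 * Real.pi * Complex.I * (lam * z + starRingEnd ℂ (lam * z)) =
      ((2 * Real.pi * (2 * (lam * z).re) : ℝ) : ℂ) * Complex.I := by
    rw [Complex.add_conj]
    push_cast
    ring
  rw [psi, h, Complex.norm_exp_ofReal_mul_I]

lemma continuous_psi (lam : ℂ) : Continuous (psi lam) := by
  unfold psi
  have := Complex.continuous_conj
  fun_prop

lemma measurable_relBessel [MeasurableSpace G] [BorelSpace G] (μ : ℂ) (m : ℤ) {lam : ℂ}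
    (hlam : lam ≠ 0) : Measurable (relBessel μ m lam) := by
  classical
  obtain ⟨F, hF, hFeq⟩ := exists_measurable_eq_boldJ (μ / 2) (m / 2)
  have hentry : ∀ i j, Measurable fun g : G => g.1 i j := fun i j =>
    (continuous_entry i j).measurable
  have hU : MeasurableSet U := by
    have : U = {g : G | g.1 0 0 * g.1 1 0 ≠ 0} := Set.ext mem_U_iff
    rw [this]
    exact (isOpen_ne_fun ((continuous_entry 0 0).mul (continuous_entry 1 0))
      continuous_const).measurableSet
  have hx : Measurable fun g : G => -(g.1 0 0 * g.1 1 0) / g.1.det :=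
    ((hentry 0 0).mul (hentry 1 0)).neg.div continuous_det.measurable
  have hN : Measurable fun x : ℂ => psi 1 (lam / (2 * x)) * (‖lam / (2 * x)‖ : ℂ) *
      F (lam ^ 2 / (16 * x ^ 2)) / lFactor (1 / 2) μ m := by
    have h1 : Measurable fun x : ℂ => lam / (2 * x) := by fun_prop
    have h2 : Measurable fun x : ℂ => lam ^ 2 / (16 * x ^ 2) := by fun_prop
    exact ((((continuous_psi 1).measurable.comp h1).mul
      (Complex.measurable_ofReal.comp h1.norm)).mul (hF.comp h2)).div_const _
  have hfun : relBessel μ m lam = fun g : G => if g ∈ U then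
      psi lam (g.1 1 1 / g.1 1 0) *
        (fun x : ℂ => psi 1 (lam / (2 * x)) * (‖lam / (2 * x)‖ : ℂ) *
          F (lam ^ 2 / (16 * x ^ 2)) / lFactor (1 / 2) μ m) (-(g.1 0 0 * g.1 1 0) / g.1.det)
      else 0 := by
    funext g
    by_cases hg : g ∈ U
    · rw [relBessel, if_pos hg, if_pos hg, relBesselN]
      have hx0 : -(g.1 0 0 * g.1 1 0) / g.1.det ≠ 0 :=
        div_ne_zero (neg_ne_zero.2 ((mem_U_iff g).1 hg)) (det_ne_zero g)
      dsimp only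
      rw [hFeq _ (div_ne_zero (pow_ne_zero _ hlam)
        (mul_ne_zero (by norm_num) (pow_ne_zero _ hx0)))]
    · rw [relBessel, if_neg hg, if_neg hg]
  rw [hfun]
  exact Measurable.ite hU (((continuous_psi lam).measurable.comp
    ((hentry 1 1).div (hentry 1 0))).mul (hN.comp hx)) measurable_const

/-- The factor $|\lambda/2x|$ is exactly $2\sqrt{|z|}$ for $z=\lambda^2/16x^2$, which the decay of
$\boldsymbol J$ compensates; $|x|\le X$ keeps $|z|\ge|\lambda|^2/16X^2$. -/
lemma exists_norm_relBesselN_le (μ : ℂ) (m : ℤ) {lam : ℂ} (hlam : lam ≠ 0) {X : ℝ} (hX : 0 < X) :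
    ∃ C : ℝ, ∀ x : ℂ, x ≠ 0 → ‖x‖ ≤ X → ‖relBesselN μ m lam x‖ ≤ C := by
  have hl : 0 < ‖lam‖ := norm_pos_iff.2 hlam
  obtain ⟨C, hC⟩ := exists_norm_boldJ_le (μ / 2) (m / 2)
    (r := ‖lam‖ ^ 2 / (16 * X ^ 2)) (by positivity)
  refine ⟨2 * C / ‖lFactor (1 / 2) μ m‖, fun x hx hxX => ?_⟩
  have hx0 : 0 < ‖x‖ := norm_pos_iff.2 hx
  have hz : ‖lam ^ 2 / (16 * x ^ 2)‖ = ‖lam‖ ^ 2 / (16 * ‖x‖ ^ 2) := by simp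
  have hsq : ‖lam / (2 * x)‖ = 2 * √‖lam ^ 2 / (16 * x ^ 2)‖ := by
    have : ‖lam‖ ^ 2 / (16 * ‖x‖ ^ 2) = (‖lam‖ / (4 * ‖x‖)) ^ 2 := by ring
    rw [hz, this, Real.sqrt_sq (by positivity), norm_div, norm_mul, Complex.norm_ofNat]
    field_simp
    norm_num
  have hb := hC (lam ^ 2 / (16 * x ^ 2)) (by rw [hz]; gcongr)
  rw [relBesselN, norm_div, norm_mul, norm_mul, norm_psi, one_mul, Complex.norm_real, norm_norm,
    hsq, mul_assoc 2]
  gcongr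

lemma locallyIntegrable_relBessel [MeasurableSpace G] [BorelSpace G] (μ : ℂ) (m : ℤ) {lam : ℂ}
    (hlam : lam ≠ 0) (haar : Measure G) [IsFiniteMeasureOnCompacts haar] :
    LocallyIntegrable (relBessel μ m lam) haar := by
  intro g₀
  -- The coordinate $x$ is continuous on all of $G$, also across the complement of $U$, where it
  -- vanishes; so it is bounded near every $g_0$.
  set ξ : G → ℂ := fun g => -(g.1 0 0 * g.1 1 0) / g.1.det with hξ
  have hcont : Continuous ξ :=
    ((continuous_entry 0 0).mul (continuous_entry 1 0)).neg.div continuous_det det_ne_zero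
  set X : ℝ := ‖ξ g₀‖ + 1
  obtain ⟨C, hC⟩ := exists_norm_relBesselN_le μ m hlam (X := X) (by positivity)
  have hnear : ∀ᶠ g in 𝓝 g₀, ‖ξ g‖ < X :=
    hcont.norm.continuousAt.eventually_lt_const (lt_add_one _)
  obtain ⟨K, hK, hKg⟩ := exists_compact_mem_nhds g₀
  refine ⟨K ∩ {g | ‖ξ g‖ < X}, inter_mem hKg hnear, ?_⟩
  have hopen : IsOpen {g | ‖ξ g‖ < X} := isOpen_lt hcont.norm continuous_const
  refine Measure.integrableOn_of_bounded (M := max C 0)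
    ((measure_mono Set.inter_subset_left).trans_lt hK.measure_lt_top).ne
    (measurable_relBessel μ m hlam).aestronglyMeasurable ?_
  refine (ae_restrict_iff' (hK.isClosed.measurableSet.inter hopen.measurableSet)).2
    (ae_of_all _ fun g hg => ?_)
  by_cases hgU : g ∈ U
  · rw [relBessel, if_pos hgU, norm_mul, norm_psi, one_mul]
    exact (hC _ (div_ne_zero (neg_ne_zero.2 ((mem_U_iff g).1 hgU)) (det_ne_zero g))
      hg.2.le).trans (le_max_left _ _)
  · rw [relBessel_eq_zero μ m lam hgU, norm_zero]
    exact le_max_right _ _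

lemma IsTestFunction.continuous {f : G → ℂ} (hf : IsTestFunction f) : Continuous f := by
  have hdet : ∀ g : G, (Matrix.of fun i j => g.1 i j).det ≠ 0 := fun g => det_ne_zero g
  have heq : f = fun g : G => inEntries f fun i j => g.1 i j := by
    funext g
    rw [inEntries, dif_pos (hdet g)]
    congr 1
    exact Units.ext (by ext i j; rfl)
  rw [heq]
  exact hf.2.continuousOn.comp_continuous
    (continuous_pi fun i => continuous_pi fun j => continuous_entry i j) hdet

end RelBessel

end

theorem proposition6p1
    {H : Type*} [NormedAddCommGroup H] [InnerProductSpace ℂ H] [CompleteSpace H]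
    (π : RelBessel.G →* unitary (H →L[ℂ] H))
    (hπ : RelBessel.IsIrreducibleUnitary π)
    (hdim : ¬ FiniteDimensional ℂ H)
    (hcentral : ∀ c : ℂˣ, π (RelBessel.zMat c) = 1)
    (μ : ℂ) (m : ℤ) (hμm : RelBessel.IsPrincipalSeries π μ m)
    (lam : ℂ) (hlam : lam ≠ 0)
    [MeasurableSpace RelBessel.G] [BorelSpace RelBessel.G]
    (haar : MeasureTheory.Measure RelBessel.G) [haar.IsHaarMeasure] :
    MeasureTheory.LocallyIntegrable (RelBessel.relBessel μ m lam) haar ∧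
      ∀ f : RelBessel.G → ℂ, RelBessel.IsTestFunction f →
        MeasureTheory.Integrable (fun g => f g * RelBessel.relBessel μ m lam g) haar := by
  have h := RelBessel.locallyIntegrable_relBessel μ m hlam haar
  exact ⟨h, fun f hf => by
    simpa only [smul_eq_mul] using
      h.integrable_smul_left_of_hasCompactSupport hf.continuous hf.1⟩
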